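/- Let $m>2$ be an integer, and write $q=e^{2\pi i\tau}$, $e(z)=e^{2\pi i z}$ and $\zeta^r=e(\sum_i r_ix_i)$, where $\tau\in\mathbb H$, $x\in\mathbb C^n$ and $r\in\mathbb Z^n$. **Definitions.** An almost-holomorphic modular form of weight $k\in\mathbb Z$ for $\Gamma\subset \mathrm{SL}_2(\mathbb Z)$ is a function $F=\sum_j f_j\,\mathrm{Im}(\tau)^{-j}$ on $\mathbb H$ (finite sum, $f_j$ holomorphic) with $F|_k\gamma=F$ for all $\gamma\in\Gamma$ and such that, for every $\gamma\in \mathrm{SL}_2(\mathbb Z)$, $F|_k\gamma=\sum_j g_j\,\mathrm{Im}(\tau)^{-j}$ (finite sum) where each $g_j$ is holomorphic with an expansion $\sum_{v\ge 0}c(v)q^{v/N}$ for some $N\ge1$. A quasi-modular form is the coefficient $f_0$ of such an $F$. Let $n\ge 0$ and let $L$ be a symmetric rational $n\times n$ matrix with $\mathrm{Tr}(L\kappa)\in\mathbb Z$ for all symmetric integral $\kappa$ (equivalently, $L_{ii}\in\mathbb Z$ and $2L_{ij}\in\mathbb Z$). Put $\nu=\frac1{8\pi\,\mathrm{Im}(\tau)}$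 and $\alpha_i=\frac{\mathrm{Im}(x_i)}{\mathrm{Im}(\tau)}$. An almost-holomorphic Jacobi form of weight $k\in\mathbb Z$ and index $L$ for $\Gamma_0(2)\ltimes(\mathbb Z^n\oplus\mathbb Z^n)$ is a function $\Phi=\sum_{i,j}\phi_{i,j}\nu^i\alpha^j$ on $\mathbb C^n\times\mathbb H$ (finite sum, $\phi_{i,j}$ holomorphic) such that, with $$(\Phi|_{k,L}\gamma)(x,\tau)=(c\tau+d)^{-k}e\Big(-\frac{c\,x^tLx}{c\tau+d}\Big)\Phi\Big(\frac{x}{c\tau+d},\frac{a\tau+b}{c\tau+d}\Big),\qquad \gamma=\begin{pmatrix}a&b\\c&d\end{pmatrix},$$ one has: - $\Phi|_{k,L}\gamma=\Phi$ for all $\gamma\in\Gamma_0(2)$; - $\Phi(x+\lambda\tau+\mu,\tau)=e(-\lambda^tL\lambda\,\tau-2\lambda^tLx)\,\Phi(x,\tau)$ for all $\lambda,\mu\in\mathbb Z^n$; - for every $\gamma\in \mathrm{SL}_2(\mathbb Z)$, $\Phi|_{k,L}\gamma=\sum_{i,j}\psi_{i,j}\nu^i\alpha^j$ (finite sum) where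 each $\psi_{i,j}$ is holomorphic with an expansion $\sum_{v\ge0}\sum_{r\in\mathbb Z^n}c(v,r)q^{v/N}\zeta^{r/N}$ for some $N\ge 1$. A quasi-Jacobi form is the coefficient $\phi_{0,0}$ of such a $\Phi$. **Theorem.** 1. Let $f$ be a quasi-modular form of weight $k$ for $\Gamma_0(2)$ whose Fourier expansion has the form $f(\tau)=\sum_{\ell\ge0}a_\ell q^{\ell m}$. If $k\ne0$, then $f=0$. If $k=0$, then $f$ is constant. 2. Let $f(x,\tau)$ be a quasi-Jacobi form of weight $k$ and index $L$ for $\Gamma_0(2)\ltimes(\mathbb Z^n\oplus\mathbb Z^n)$ with a Fourier–Jacobi expansion $f=\sum_{v\in\mathbb Z}\sum_{r\in\mathbb Z^n}c(v,r)q^v\zeta^r$ such that $c(v,r)\ne0$ only if $m\mid v$. If $L\neq0$ or $k\ne0$, then $f=0$. If $L=0$ and $k=0$, then $f$ is constant. 3. The subgroup of $\mathrm{SL}_2(\mathbb R)$ generated by $\Gamma_0(2)$ and $\begin{pmatrix}1&1/m\\0&1\end{pmatrix}$ is dense in $\mathrm{SL}_2(\mathbb R)$. -/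

import Mathlib

open UpperHalfPlane
open scoped MatrixGroups ModularForm

noncomputable section

namespace QuasiJacobi

/-- `e(z) = exp(2πiz)`. -/
def e (z : ℂ) : ℂ := Complex.exp (2 * Real.pi * Complex.I * z)

/-! ### Quasi-modular forms -/

/-- Holomorphic functions on the upper half plane. -/
def Hol (f : ℍ → ℂ) : Prop :=
  DifferentiableOn ℂ (fun z : ℂ => f (ofComplex z)) {z : ℂ | 0 < z.im}

/-- `F = ∑_j f_j y^{-j}` with `y = Im τ`, where the (finitely many non-zero) `f_j` are
holomorphic on the upper half plane. -/
def IsAlmostHolExpansion (F : ℍ → ℂ) (f : ℕ →₀ (ℍ → ℂ)) : Prop :=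
  (∀ j, Hol (f j)) ∧
    ∀ τ : ℍ, F τ = f.sum fun j g => g τ * ((τ.im : ℂ)⁻¹) ^ j

/-- `f` has a Fourier expansion `∑_{v ≥ 0} c(v) q^{v/N}` for some `N ≥ 1`. -/
def HasQExpansion (f : ℍ → ℂ) : Prop :=
  ∃ N : ℕ, 1 ≤ N ∧ ∃ c : ℕ → ℂ,
    ∀ τ : ℍ, HasSum (fun v : ℕ => c v * e ((v : ℂ) * (τ : ℂ) / N)) (f τ)

/-- `F` is an almost-holomorphic modular form of weight `k` for `Γ`. -/
structure IsAlmostHolModularForm (k : ℤ) (Γ : Subgroup SL(2, ℤ)) (F : ℍ → ℂ) : Prop where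
  almostHol : ∃ f, IsAlmostHolExpansion F f
  slash_eq : ∀ γ ∈ Γ, F ∣[k] γ = F
  cusps : ∀ γ : SL(2, ℤ), ∃ f, IsAlmostHolExpansion (F ∣[k] γ) f ∧ ∀ j, HasQExpansion (f j)

/-- `f` is a quasi-modular form of weight `k` for `Γ`: the constant term (the coefficient
of `y^0`) of an almost-holomorphic modular form of the same kind. -/
def IsQuasiModularForm (k : ℤ) (Γ : Subgroup SL(2, ℤ)) (f : ℍ → ℂ) : Prop :=
  ∃ F φ, IsAlmostHolModularForm k Γ F ∧ IsAlmostHolExpansion F φ ∧ φ 0 = f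

/-! ### Quasi-Jacobi forms of lattice index -/

variable {n : ℕ}

/-- Holomorphic functions on `ℂⁿ × ℍ`. -/
def JacHol (φ : (Fin n → ℂ) → ℍ → ℂ) : Prop :=
  DifferentiableOn ℂ (fun p : (Fin n → ℂ) × ℂ => φ p.1 (ofComplex p.2))
    {p : (Fin n → ℂ) × ℂ | 0 < p.2.im}

/-- `ν(τ) = 1 / (8π Im τ)`. -/
def nu (τ : ℍ) : ℂ := 1 / (8 * Real.pi * τ.im)

/-- `α_l(x, τ) = Im x_l / Im τ`. -/
def alpha (x : Fin n → ℂ) (τ : ℍ) (l : Fin n) : ℂ := ((x l).im : ℂ) / (τ.im : ℂ)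

/-- `Φ = ∑_{i,j} φ_{i,j} ν^i α^j`, where the (finitely many non-zero) `φ_{i,j}` are holomorphic
on `ℂⁿ × ℍ`. -/
def IsJacAlmostHolExpansion (Φ : (Fin n → ℂ) → ℍ → ℂ)
    (φ : (ℕ × (Fin n → ℕ)) →₀ ((Fin n → ℂ) → ℍ → ℂ)) : Prop :=
  (∀ p, JacHol (φ p)) ∧
    ∀ (x : Fin n → ℂ) (τ : ℍ),
      Φ x τ = φ.sum fun p g => g x τ * nu τ ^ p.1 * ∏ l, alpha x τ l ^ p.2 l

/-- `φ` has a Fourier expansion `∑_{v ≥ 0} ∑_{r ∈ ℤⁿ} c(v,r) q^{v/N} e((∑ x_i r_i)/N)` for some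
`N ≥ 1`. -/
def HasJacQExpansion (φ : (Fin n → ℂ) → ℍ → ℂ) : Prop :=
  ∃ N : ℕ, 1 ≤ N ∧ ∃ c : ℕ → (Fin n → ℤ) → ℂ,
    ∀ (x : Fin n → ℂ) (τ : ℍ),
      HasSum (fun p : ℕ × (Fin n → ℤ) =>
        c p.1 p.2 * e ((p.1 : ℂ) * (τ : ℂ) / N) * e ((∑ i, x i * (p.2 i : ℂ)) / N)) (φ x τ)

/-- The complex bilinear form `x^t L y`. -/
def bil (L : Matrix (Fin n) (Fin n) ℚ) (x y : Fin n → ℂ) : ℂ :=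
  ∑ i, ∑ j, x i * (L i j : ℂ) * y j

/-- `(cτ+d)^{-k} e(-c x^t L x / (cτ+d)) Φ(x/(cτ+d), (aτ+b)/(cτ+d))` for `γ = (a b; c d)`. -/
def jacSlash (k : ℤ) (L : Matrix (Fin n) (Fin n) ℚ) (γ : SL(2, ℤ))
    (Φ : (Fin n → ℂ) → ℍ → ℂ) : (Fin n → ℂ) → ℍ → ℂ := fun x τ =>
  let J : ℂ := (γ 1 0 : ℂ) * (τ : ℂ) + (γ 1 1 : ℂ)
  J ^ (-k) * e (-((γ 1 0 : ℂ) * bil L x x / J)) * Φ (fun i => x i / J) (γ • τ)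

/-- `L` is an index for the lattice `Λ ⊆ ℤ^{(n,2)}`, whose elements are written as pairs
`(lam, mu)` of columns: `L` is symmetric and `Tr(L κ) ∈ ℤ` for every symmetric `κ` in the
`ℤ`-span of the matrices `mu lam^t` and `lam mu^t` with `(lam, mu) ∈ Λ`. -/
def IsIndex (Λ : AddSubgroup ((Fin n → ℤ) × (Fin n → ℤ))) (L : Matrix (Fin n) (Fin n) ℚ) : Prop :=
  L.IsSymm ∧
    ∀ κ ∈ AddSubgroup.closure {M : Matrix (Fin n) (Fin n) ℤ | ∃ p ∈ Λ,
        M = Matrix.vecMulVec p.2 p.1 ∨ M = Matrix.vecMulVec p.1 p.2},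
      κ.IsSymm → ∃ t : ℤ, (L * κ.map (Int.cast : ℤ → ℚ)).trace = t

/-- `Φ` is an almost-holomorphic (weak) Jacobi form of weight `k` and index `L` for `Γ ⋉ Λ`. -/
structure IsAlmostHolJacobiForm (k : ℤ) (L : Matrix (Fin n) (Fin n) ℚ) (Γ : Subgroup SL(2, ℤ))
    (Λ : AddSubgroup ((Fin n → ℤ) × (Fin n → ℤ))) (Φ : (Fin n → ℂ) → ℍ → ℂ) : Prop where
  almostHol : ∃ φ, IsJacAlmostHolExpansion Φ φ
  slash_eq : ∀ γ ∈ Γ, jacSlash k L γ Φ = Φ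
  elliptic : ∀ p ∈ Λ, ∀ (x : Fin n → ℂ) (τ : ℍ),
    Φ (fun i => x i + (p.1 i : ℂ) * (τ : ℂ) + (p.2 i : ℂ)) τ =
      e (-(bil L (fun i => (p.1 i : ℂ)) (fun i => (p.1 i : ℂ)) * (τ : ℂ))
          - 2 * bil L (fun i => (p.1 i : ℂ)) x) * Φ x τ
  cusps : ∀ γ : SL(2, ℤ), ∃ φ, IsJacAlmostHolExpansion (jacSlash k L γ Φ) φ ∧
    ∀ p, HasJacQExpansion (φ p)

/-- `f` is a quasi-Jacobi form of weight `k` and index `L` for `Γ ⋉ Λ`: the coefficient of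
`ν^0 α^0` of an almost-holomorphic Jacobi form of the same kind. -/
def IsQuasiJacobiForm (k : ℤ) (L : Matrix (Fin n) (Fin n) ℚ) (Γ : Subgroup SL(2, ℤ))
    (Λ : AddSubgroup ((Fin n → ℤ) × (Fin n → ℤ))) (f : (Fin n → ℂ) → ℍ → ℂ) : Prop :=
  ∃ Φ φ, IsAlmostHolJacobiForm k L Γ Λ Φ ∧ IsJacAlmostHolExpansion Φ φ ∧ φ (0, 0) = f

/-- The matrix `(1 t; 0 1)` in `SL₂(ℝ)`. -/
def upper (t : ℝ) : SL(2, ℝ) := ⟨!![1, t; 0, 1], by simp [Matrix.det_fin_two_of]⟩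

end QuasiJacobi

end

/-!
All three claims come from the group generated by `Γ₀(2)` and `T = (1 1/m; 0 1)`, which is dense in
`SL₂(ℝ)`. For `m > 2` this group contains an upper triangular matrix with diagonal entries
`u, u⁻¹` and `|u| > 1` (`exists_hyperbolic_mem_extendedGamma`). Conjugating `T` by its powers gives
arbitrarily short translations, so the closure contains all real translations
(`upper_mem_of_isClosed`), and together with `(1 0; 2 1)` these generate `SL₂(ℝ)`
(`eq_top_of_upper_mem`).

Let `Φ = ∑ φ_{i,j} ν^i α^j` be an almost-holomorphic Jacobi form, and
`P(x, τ, N, A) = ∑ φ_{i,j}(x, τ) N^i A^j`, so that the quasi-Jacobi form is `f = P(x, τ, 0, 0)`.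
The functions `ν` and `α` are independent over the holomorphic functions
(`eq_zero_of_eq_zero_nu_alpha`): for fixed values of them `Im τ` and `Im x` are fixed, and a
holomorphic function vanishing on such a set vanishes identically. Hence the transformation laws of
`Φ` hold for `P`, with `N ↦ J² N + cJ / 4πi`, `A ↦ J A - c x` for `J = cτ + d`, and `A ↦ A + λ` for
the lattice (`IsHolPoly.smul_eq`, `IsHolPoly.add_eq`).

The shape of the Fourier expansion says `f(x, τ + 1/m) = f(x, τ)`. Transporting this identity from
`N = A = 0` by those elements of the Jacobi group that stay in the group after conjugation by `T`
reaches a Zariski dense set of values of `(N, A)`, so `P`, and therefore `Φ`, is invariant under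
`τ ↦ τ + 1/m` (`IsHolPoly.upper_smul_eq`). By density and continuity `Φ` is invariant under
`SL₂(ℝ)`. This spreads the integral translations of `x` to all `x ↦ x + w + vτ` with real `v, w`.
As the latter commute while their factors commute only up to `e(-2 vᵗLw)`, either `Φ = 0` or
`L = 0` (`index_eq_zero_of_ne_zero`). If `L = 0` then `Φ` does not depend on `x`, it is determined
by its value at `τ = i`, and the rotation by `π / k` makes this value vanish when `k ≠ 0`. So `Φ`
is constant (`exists_eq_const_of_isInvariant`), hence so are `P` and `f`. Quasi-modular forms are
the case `n = 0`.
-/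

open UpperHalfPlane
open scoped MatrixGroups ModularForm

noncomputable section

namespace QuasiJacobi

/-! ### Density of the group generated by `Γ₀(2)` and a short translation -/

/-- The matrix `(1 0; t 1)` in `SL₂(ℝ)`. -/
def lower (t : ℝ) : SL(2, ℝ) := ⟨!![1, 0; t, 1], by simp [Matrix.det_fin_two_of]⟩

lemma sl_ext {g h : SL(2, ℝ)} (h00 : g 0 0 = h 0 0) (h01 : g 0 1 = h 0 1) (h10 : g 1 0 = h 1 0)
    (h11 : g 1 1 = h 1 1) : g = h := by
  ext i j
  fin_cases i <;> fin_cases j <;> assumption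

lemma sl_mul_apply (g h : SL(2, ℝ)) (i j : Fin 2) :
    (g * h) i j = g i 0 * h 0 j + g i 1 * h 1 j := by
  simp [Matrix.mul_apply, Fin.sum_univ_two]

lemma sl_det (g : SL(2, ℝ)) : g 0 0 * g 1 1 - g 0 1 * g 1 0 = 1 := by
  rw [← Matrix.det_fin_two, g.det_coe]

@[simp] lemma upper_00 (t : ℝ) : upper t 0 0 = 1 := rfl
@[simp] lemma upper_01 (t : ℝ) : upper t 0 1 = t := rfl
@[simp] lemma upper_10 (t : ℝ) : upper t 1 0 = 0 := rfl
@[simp] lemma upper_11 (t : ℝ) : upper t 1 1 = 1 := rfl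
@[simp] lemma lower_00 (t : ℝ) : lower t 0 0 = 1 := rfl
@[simp] lemma lower_01 (t : ℝ) : lower t 0 1 = 0 := rfl
@[simp] lemma lower_10 (t : ℝ) : lower t 1 0 = t := rfl
@[simp] lemma lower_11 (t : ℝ) : lower t 1 1 = 1 := rfl

lemma upper_add (s t : ℝ) : upper (s + t) = upper s * upper t := by
  apply sl_ext <;> simp [sl_mul_apply, add_comm]

lemma upper_zero : upper 0 = 1 := by
  apply sl_ext <;> simp

lemma upper_neg (s : ℝ) : upper (-s) = (upper s)⁻¹ := by
  rw [eq_inv_iff_mul_eq_one, ← upper_add, neg_add_cancel, upper_zero]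

lemma continuous_upper : Continuous upper := by
  refine Continuous.subtype_mk (continuous_matrix fun i j => ?_) _
  fin_cases i <;> fin_cases j <;> simp <;> fun_prop

/-- The parameters `s` with `(1 s; 0 1) ∈ G`. -/
def translations (G : Subgroup SL(2, ℝ)) : AddSubgroup ℝ where
  carrier := {s | upper s ∈ G}
  add_mem' {s t} hs ht := by
    simpa only [Set.mem_ofPred_eq, upper_add] using G.mul_mem hs ht
  zero_mem' := by simpa only [Set.mem_ofPred_eq, upper_zero] using G.one_mem
  neg_mem' {s} hs := by simpa only [Set.mem_ofPred_eq, upper_neg] using G.inv_mem hs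

@[simp] lemma mem_translations {G : Subgroup SL(2, ℝ)} {s : ℝ} :
    s ∈ translations G ↔ upper s ∈ G := Iff.rfl

lemma upper_conj {g : SL(2, ℝ)} (hg : g 1 0 = 0) (s : ℝ) :
    g⁻¹ * upper s * g = upper (s * g 1 1 ^ 2) := by
  have hd := sl_det g
  rw [hg] at hd
  rw [mul_assoc, inv_mul_eq_iff_eq_mul]
  apply sl_ext <;> simp [sl_mul_apply, hg]
  linear_combination (-s * g 1 1) * hd

/-- A closed subgroup with a non-trivial translation and an upper triangular element with
diagonal entries of absolute value different from `1` contains every translation: conjugation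
makes the translation as short as one likes. -/
lemma upper_mem_of_isClosed {G : Subgroup SL(2, ℝ)} (hG : IsClosed (G : Set SL(2, ℝ)))
    {t : ℝ} (ht : 0 < t) (htG : upper t ∈ G) {g : SL(2, ℝ)} (hg : g ∈ G) (h10 : g 1 0 = 0)
    (h00 : 1 < |g 0 0|) (s : ℝ) : upper s ∈ G := by
  have hd : g 0 0 * g 1 1 = 1 := by simpa [h10] using sl_det g
  have h11 : |g 1 1| < 1 := by
    have h : |g 0 0| * |g 1 1| = 1 := by rw [← abs_mul, hd, abs_one]
    nlinarith [abs_nonneg (g 1 1)]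
  have h11' : g 1 1 ≠ 0 := right_ne_zero_of_mul_eq_one hd
  have hj : ∀ j : ℕ, upper (t * (g 1 1 ^ 2) ^ j) ∈ G := by
    intro j
    induction j with
    | zero => simpa using htG
    | succ j ih =>
      rw [pow_succ, ← mul_assoc, ← upper_conj h10]
      exact G.mul_mem (G.mul_mem (G.inv_mem hg) ih) hg
  have hdense : Dense (translations G : Set ℝ) := by
    refine AddSubgroup.dense_of_not_isolated_zero _ fun ε hε => ?_
    obtain ⟨j, hj'⟩ := exists_pow_lt_of_lt_one (div_pos hε ht)
      (show g 1 1 ^ 2 < 1 by rwa [sq_lt_one_iff_abs_lt_one])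
    refine ⟨_, hj j, by positivity, ?_⟩
    rwa [lt_div_iff₀' ht] at hj'
  have hclosed : IsClosed (translations G : Set ℝ) := hG.preimage continuous_upper
  have : s ∈ closure (translations G : Set ℝ) := hdense s
  rwa [hclosed.closure_eq] at this

/-- The Bruhat decomposition, in the form: all translations and one lower triangular unipotent
generate `SL₂(ℝ)`. -/
lemma eq_top_of_upper_mem {G : Subgroup SL(2, ℝ)} (hU : ∀ s, upper s ∈ G)
    (hV : lower 2 ∈ G) : G = ⊤ := by
  have key : ∀ g : SL(2, ℝ), g 1 0 = 2 → g ∈ G := by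
    intro g hg
    have hd := sl_det g
    have : g = upper ((g 0 0 - 1) / 2) * lower 2 * upper ((g 1 1 - 1) / 2) := by
      apply sl_ext <;> simp [sl_mul_apply, hg]
      · rw [hg] at hd
        linear_combination -hd / 2
      · ring
    rw [this]
    exact G.mul_mem (G.mul_mem (hU _) hV) (hU _)
  have key' : ∀ g : SL(2, ℝ), g 1 0 ≠ 0 → g ∈ G := by
    intro g hg
    -- the upper left entry of `h` is chosen so that `h * g` has lower left entry `2`
    set h : SL(2, ℝ) := lower 2 * upper ((2 - g 1 0 - 2 * g 0 0) / (2 * g 1 0)) with hh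
    have h2 : h ∈ G := G.mul_mem hV (hU _)
    have h3 : h * g ∈ G := by
      apply key
      simp [hh, sl_mul_apply]
      field_simp
      ring
    exact (G.mul_mem_cancel_left h2).1 h3
  refine eq_top_iff.2 fun g _ => ?_
  by_cases hg : g 1 0 = 0
  · refine (G.mul_mem_cancel_left hV).1 (key' _ ?_)
    have hd := sl_det g
    simp only [hg, mul_zero, sub_zero] at hd
    simpa [sl_mul_apply, hg] using left_ne_zero_of_mul_eq_one hd
  · exact key' g hg

/-- The subgroup of `SL₂(ℝ)` generated by `Γ₀(2)` and `(1 1/m; 0 1)`. -/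
def extendedGamma (m : ℕ) : Subgroup SL(2, ℝ) :=
  Subgroup.closure
    (((CongruenceSubgroup.Gamma0 2).map
        (Matrix.SpecialLinearGroup.map (n := Fin 2) (Int.castRingHom ℝ)) :
          Set (Matrix.SpecialLinearGroup (Fin 2) ℝ)) ∪ {upper (1 / (m : ℝ))})

lemma map_int_apply (γ : SL(2, ℤ)) (i j : Fin 2) :
    Matrix.SpecialLinearGroup.map (n := Fin 2) (Int.castRingHom ℝ) γ i j = (γ i j : ℝ) := rfl

/-- A real matrix with integral entries and even lower left entry comes from `Γ₀(2)`. -/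
lemma mem_map_Gamma0 {g : SL(2, ℝ)} {a b c d : ℤ} (h00 : g 0 0 = a) (h01 : g 0 1 = b)
    (h10 : g 1 0 = 2 * c) (h11 : g 1 1 = d) :
    g ∈ (CongruenceSubgroup.Gamma0 2).map
      (Matrix.SpecialLinearGroup.map (n := Fin 2) (Int.castRingHom ℝ)) := by
  have hd : a * d - b * (2 * c) = 1 := by
    have h := sl_det g
    rw [h00, h01, h10, h11] at h
    exact_mod_cast h
  let γ : SL(2, ℤ) := ⟨!![a, b; 2 * c, d], by rw [Matrix.det_fin_two_of, hd]⟩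
  refine ⟨γ, ?_, ?_⟩
  · rw [SetLike.mem_coe, CongruenceSubgroup.Gamma0_mem]
    change ((2 * c : ℤ) : ZMod 2) = 0
    rw [Int.cast_mul]
    exact mul_eq_zero_of_left rfl _
  · have h : ((2 * c : ℤ) : ℝ) = 2 * c := by push_cast; rfl
    exact sl_ext h00.symm h01.symm (h.trans h10.symm) h11.symm

lemma lower_mem_map_Gamma0 (c : ℤ) :
    lower (2 * c) ∈ (CongruenceSubgroup.Gamma0 2).map
      (Matrix.SpecialLinearGroup.map (n := Fin 2) (Int.castRingHom ℝ)) :=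
  mem_map_Gamma0 (a := 1) (b := 0) (c := c) (d := 1) (by simp) (by simp) (by simp) (by simp)

lemma lower_mem_extendedGamma (m : ℕ) (c : ℤ) : lower (2 * c) ∈ extendedGamma m :=
  Subgroup.subset_closure (Or.inl (lower_mem_map_Gamma0 c))

lemma upper_mem_extendedGamma (m : ℕ) (j : ℤ) : upper (j * (1 / (m : ℝ))) ∈ extendedGamma m := by
  have h : (1 / (m : ℝ)) ∈ translations (extendedGamma m) :=
    Subgroup.subset_closure (Or.inr rfl)
  simpa using (translations (extendedGamma m)).zsmul_mem h j

/-- The hyperbolic element fixing the cusp `∞`. With `c = 2m` for odd `m` and `c = m` for even `m`,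
a suitable power of the short translation maps the first column `(1, c)` of `(1 0; c 1)` to a
multiple `u (1, 2)`, with `u = m` and `u = m / 2` respectively; `m > 2` makes `u > 1`. -/
lemma exists_hyperbolic_mem_extendedGamma {m : ℕ} (hm : 2 < m) :
    ∃ g ∈ extendedGamma m, g 1 0 = 0 ∧ 1 < |g 0 0| := by
  obtain ⟨r, hr | hr⟩ := Nat.even_or_odd' m
  · have hr1 : (1 : ℝ) < r := by exact_mod_cast (by omega : 1 < r)
    have hmr : (m : ℝ) = 2 * r := by rw [hr]; push_cast; ring
    refine ⟨_, mul_mem (mul_mem (lower_mem_extendedGamma m (-1))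
      (upper_mem_extendedGamma m (r - 1))) (lower_mem_extendedGamma m r), ?_, ?_⟩
    · simp [sl_mul_apply, hmr]
      field_simp
      ring
    · have : (1 : ℝ) + (r - 1) * (1 / m) * (2 * r) = r := by rw [hmr]; field_simp; ring
      have h : 1 < |(1 : ℝ) + (r - 1) * (1 / m) * (2 * r)| := by
        rw [this, abs_of_pos (by linarith)]; exact hr1
      simpa [sl_mul_apply] using h
  · have hr1 : (1 : ℝ) ≤ r := by exact_mod_cast (by omega : 1 ≤ r)
    have hmr : (m : ℝ) = 2 * r + 1 := by rw [hr]; push_cast; ring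
    refine ⟨_, mul_mem (mul_mem (lower_mem_extendedGamma m (-1))
      (upper_mem_extendedGamma m r)) (lower_mem_extendedGamma m m), ?_, ?_⟩
    · simp [sl_mul_apply, hmr]
      field_simp
      ring
    · have : (1 : ℝ) + r * (1 / m) * (2 * m) = m := by rw [hmr]; field_simp; ring
      have h : 1 < |(1 : ℝ) + r * (1 / m) * (2 * m)| := by
        rw [this, abs_of_pos (by positivity)]; linarith
      simpa [sl_mul_apply] using h

theorem dense_extendedGamma {m : ℕ} (hm : 2 < m) : Dense (extendedGamma m : Set SL(2, ℝ)) := by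
  obtain ⟨g, hg, h10, h00⟩ := exists_hyperbolic_mem_extendedGamma hm
  have hle := (extendedGamma m).le_topologicalClosure
  have ht : upper (1 / (m : ℝ)) ∈ extendedGamma m := Subgroup.subset_closure (Or.inr rfl)
  have htop : (extendedGamma m).topologicalClosure = ⊤ :=
    eq_top_of_upper_mem
      (upper_mem_of_isClosed (extendedGamma m).isClosed_topologicalClosure (by positivity)
        (hle ht) (hle hg) h10 h00)
      (hle (by simpa using lower_mem_extendedGamma m 1))
  rw [dense_iff_closure_eq, ← Subgroup.topologicalClosure_coe, htop, Subgroup.coe_top]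

/-! ### Holomorphic functions on `ℂⁿ × ℍ` -/

variable {n : ℕ}

lemma JacHol.comp {φ : (Fin n → ℂ) → ℍ → ℂ} (hφ : JacHol φ) {E : Type*}
    [NormedAddCommGroup E] [NormedSpace ℂ E] {s : Set E} {u : E → Fin n → ℂ} {v : E → ℂ}
    (hu : DifferentiableOn ℂ u s) (hv : DifferentiableOn ℂ v s) (h : ∀ p ∈ s, 0 < (v p).im) :
    DifferentiableOn ℂ (fun p => φ (u p) (ofComplex (v p))) s :=
  DifferentiableOn.comp (g := fun p : (Fin n → ℂ) × ℂ => φ p.1 (ofComplex p.2))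
    (f := fun p => (u p, v p)) hφ (hu.prodMk hv) h

/-- The identity theorem, for functions vanishing on the positive real points of the domain. -/
lemma eq_zero_of_forall_pos_real {D : ℂ → ℂ} {U : Set ℂ} (hU : IsOpen U) (hU' : IsPreconnected U)
    (hD : DifferentiableOn ℂ D U) (h1 : (1 : ℂ) ∈ U)
    (h : ∀ r : ℝ, 0 < r → D r = 0) {z : ℂ} (hz : z ∈ U) : D z = 0 := by
  refine (hD.analyticOnNhd hU).eqOn_zero_of_preconnected_of_frequently_eq_zero hU' h1 ?_ hz
  have h2 : Filter.Tendsto (fun r : ℝ => (r : ℂ)) (nhdsWithin 1 {1}ᶜ) (nhdsWithin 1 {1}ᶜ) := by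
    refine tendsto_nhdsWithin_of_tendsto_nhds_of_eventually_within _ ?_ ?_
    · exact (Complex.continuous_ofReal.tendsto' 1 1 (by simp)).mono_left nhdsWithin_le_nhds
    · filter_upwards [self_mem_nhdsWithin] with r hr
      simpa using hr
  refine h2.frequently (Filter.Eventually.frequently ?_)
  filter_upwards [mem_nhdsWithin_of_mem_nhds (lt_mem_nhds one_pos)] with r hr
  exact h r hr

/-- A holomorphic function on `ℂⁿ × ℍ` that vanishes wherever `Im x = a` and `Im τ = b` is zero:
it vanishes on the real points of every complex line in a real direction through such a point, and
these lines cover `ℂⁿ × ℍ`. -/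
lemma JacHol.eq_zero_of_im_eq {φ : (Fin n → ℂ) → ℍ → ℂ} (hφ : JacHol φ) (a : Fin n → ℝ) {b : ℝ}
    (hb : 0 < b) (h : ∀ (x : Fin n → ℂ) (τ : ℍ), (∀ i, (x i).im = a i) → τ.im = b → φ x τ = 0)
    (x : Fin n → ℂ) (τ : ℍ) : φ x τ = 0 := by
  set u : ℂ → Fin n → ℂ := fun z i =>
    ((x i).re + Complex.I * a i) + z * ((x i).im - a i : ℝ) with hu
  set v : ℂ → ℂ := fun z => (τ.re + Complex.I * b) + z * (τ.im - b : ℝ) with hv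
  have hv_im : ∀ z, (v z).im = b + z.im * (τ.im - b) := by intro z; simp [hv]
  set U : Set ℂ := {z | 0 < (v z).im} with hUdef
  have hvc : Continuous v := by fun_prop
  have hU : IsOpen U := isOpen_lt continuous_const (Complex.continuous_im.comp hvc)
  have hUc : Convex ℝ U := by
    have : U = {z | -b < Complex.imLm z * (τ.im - b)} := by
      ext z
      simp only [hUdef, Set.mem_ofPred_eq, hv_im, Complex.imLm_coe]
      constructor <;> intro h <;> linarith
    rw [this]
    exact convex_halfSpace_gt ⟨fun z w => by simp [add_mul], fun c z => by simp [mul_assoc]⟩ _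
  have hD : DifferentiableOn ℂ (fun z => φ (u z) (ofComplex (v z))) U :=
    hφ.comp (by fun_prop) (by fun_prop) fun _ hp => hp
  have hreal : ∀ r : ℝ, (v r).im = b := fun r => by simp [hv_im]
  have h0 := eq_zero_of_forall_pos_real hU hUc.isPreconnected hD
    (by simpa [hUdef, hreal] using! (show 0 < (v 1).im by simp [hv_im, hb]))
    (fun r _ => h _ _ (fun i => by simp [hu])
      (by rw [ofComplex_apply_of_im_pos (by rw [hreal]; exact hb)]; exact hreal r))
    (z := Complex.I) (by simp [hUdef, hv_im, τ.im_pos])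
  have hux : u Complex.I = x := by
    funext i
    apply Complex.ext <;> simp [hu]
  have hvx : v Complex.I = τ := by
    apply Complex.ext <;> simp [hv]
  simpa [hux, hvx] using h0

/-! ### Polynomial extensions of almost-holomorphic functions -/

/-- `P(x, τ, N, A)` is holomorphic and, for fixed `(x, τ)`, polynomial in `(N, A)`. Substituting
`ν` for `N` and `α` for `A` produces the almost-holomorphic functions. -/
structure IsHolPoly (P : (Fin n → ℂ) → ℍ → ℂ → (Fin n → ℂ) → ℂ) : Prop where
  hol : DifferentiableOn ℂ
    (fun p : (Fin n → ℂ) × ℂ × ℂ × (Fin n → ℂ) => P p.1 (ofComplex p.2.1) p.2.2.1 p.2.2.2)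
    {p | 0 < p.2.1.im}
  poly : ∀ x τ, ∃ q : MvPolynomial (Option (Fin n)) ℂ,
    ∀ N A, P x τ N A = q.eval fun o => o.elim N A

variable {P : (Fin n → ℂ) → ℍ → ℂ → (Fin n → ℂ) → ℂ}

lemma IsHolPoly.comp (hP : IsHolPoly P) {E : Type*} [NormedAddCommGroup E] [NormedSpace ℂ E]
    {s : Set E} {u : E → Fin n → ℂ} {v N : E → ℂ} {A : E → Fin n → ℂ}
    (hu : DifferentiableOn ℂ u s) (hv : DifferentiableOn ℂ v s) (hN : DifferentiableOn ℂ N s)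
    (hA : DifferentiableOn ℂ A s) (h : ∀ p ∈ s, 0 < (v p).im) :
    DifferentiableOn ℂ (fun p => P (u p) (ofComplex (v p)) (N p) (A p)) s :=
  DifferentiableOn.comp
    (g := fun p : (Fin n → ℂ) × ℂ × ℂ × (Fin n → ℂ) =>
      P p.1 (ofComplex p.2.1) p.2.2.1 p.2.2.2)
    (f := fun p => (u p, v p, N p, A p)) hP.hol (hu.prodMk (hv.prodMk (hN.prodMk hA))) h

lemma IsHolPoly.jacHol (hP : IsHolPoly P) (N : ℂ) (A : Fin n → ℂ) :
    JacHol fun x τ => P x τ N A :=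
  hP.comp (by fun_prop) (by fun_prop) (by fun_prop) (by fun_prop) fun _ hp => hp

lemma IsHolPoly.differentiable (hP : IsHolPoly P) (x : Fin n → ℂ) (τ : ℍ) :
    Differentiable ℂ fun p : ℂ × (Fin n → ℂ) => P x τ p.1 p.2 := by
  have h := hP.comp (s := Set.univ) (u := fun _ => x) (v := fun _ => (τ : ℂ))
    (N := fun p : ℂ × (Fin n → ℂ) => p.1) (A := fun p => p.2) (by fun_prop) (by fun_prop)
    (by fun_prop) (by fun_prop) (fun _ _ => τ.im_pos)
  simpa [differentiableOn_univ] using! h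

lemma continuous_nu : Continuous nu := by
  unfold nu
  refine continuous_const.div (by fun_prop) fun τ => ?_
  have : (τ.im : ℂ) ≠ 0 := by exact_mod_cast τ.im_pos.ne'
  have h : (Real.pi : ℂ) ≠ 0 := by exact_mod_cast Real.pi_ne_zero
  simp [this, h]

lemma continuous_alpha : Continuous fun p : (Fin n → ℂ) × ℍ => alpha p.1 p.2 := by
  unfold alpha
  refine continuous_pi fun l => Continuous.div (by fun_prop) (by fun_prop) fun p => ?_
  exact_mod_cast p.2.im_pos.ne'

lemma IsHolPoly.continuous (hP : IsHolPoly P) :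
    Continuous fun p : (Fin n → ℂ) × ℍ => P p.1 p.2 (nu p.2) (alpha p.1 p.2) := by
  have h := hP.hol.continuousOn.comp_continuous
    (f := fun p : (Fin n → ℂ) × ℍ => (p.1, (p.2 : ℂ), nu p.2, alpha p.1 p.2))
    (by have := continuous_nu; have := continuous_alpha (n := n); fun_prop) (fun p => p.2.im_pos)
  simpa [Function.comp_def] using h

lemma IsHolPoly.polynomial_left (hP : IsHolPoly P) (x : Fin n → ℂ) (τ : ℍ) (A : Fin n → ℂ) :
    ∃ q : Polynomial ℂ, ∀ N, P x τ N A = q.eval N := by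
  obtain ⟨q, hq⟩ := hP.poly x τ
  refine ⟨q.aeval fun o => o.elim Polynomial.X fun l => Polynomial.C (A l), fun N => ?_⟩
  rw [hq, ← Polynomial.coe_evalRingHom, MvPolynomial.map_aeval, MvPolynomial.eval,
    MvPolynomial.coe_eval₂Hom]
  congr 1
  · ext; simp
  · funext o; cases o <;> simp

lemma IsHolPoly.polynomial_right (hP : IsHolPoly P) (x : Fin n → ℂ) (τ : ℍ) (N : ℂ) :
    ∃ q : MvPolynomial (Fin n) ℂ, ∀ A, P x τ N A = q.eval A := by
  obtain ⟨q, hq⟩ := hP.poly x τ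
  refine ⟨q.aeval fun o => o.elim (MvPolynomial.C N) MvPolynomial.X, fun A => ?_⟩
  rw [hq, MvPolynomial.map_aeval, MvPolynomial.eval, MvPolynomial.coe_eval₂Hom]
  congr 1
  · ext; simp
  · funext o; cases o <;> simp

/-- The variables `ν` and `α` are independent over the holomorphic functions. Fixing real values of
`ν` and `α` amounts to fixing `Im τ` and `Im x`, so that the identity theorem applies first in
`(x, τ)` and then in `(N, A)`. -/
lemma eq_zero_of_eq_zero_nu_alpha {G : (Fin n → ℂ) → ℍ → ℂ → (Fin n → ℂ) → ℂ}
    (hol : ∀ N A, JacHol fun x τ => G x τ N A)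
    (diff : ∀ x τ, Differentiable ℂ fun p : ℂ × (Fin n → ℂ) => G x τ p.1 p.2)
    (h : ∀ x τ, G x τ (nu τ) (alpha x τ) = 0)
    (x : Fin n → ℂ) (τ : ℍ) (N : ℂ) (A : Fin n → ℂ) : G x τ N A = 0 := by
  have h1 : ∀ (x : Fin n → ℂ) (τ : ℍ) (N : ℝ) (A : Fin n → ℝ), 0 < N →
      G x τ N (fun i => A i) = 0 := by
    intro x τ N A hN
    set b : ℝ := 1 / (8 * Real.pi * N) with hb
    have hbpos : 0 < b := by positivity
    refine (hol _ _).eq_zero_of_im_eq (fun i => A i * b) hbpos (fun x τ hx hτ => ?_) x τ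
    convert h x τ using 2
    · rw [nu, hτ, hb]
      push_cast
      have : (N : ℂ) ≠ 0 := by exact_mod_cast hN.ne'
      field_simp
    · funext i
      rw [alpha, hx, hτ]
      have : (b : ℂ) ≠ 0 := by exact_mod_cast hbpos.ne'
      push_cast
      field_simp
  have h2 : ∀ (N : ℂ) (A : Fin n → ℝ), G x τ N (fun i => A i) = 0 := fun N A =>
    eq_zero_of_forall_pos_real (D := fun z => G x τ z (fun i => A i)) isOpen_univ
      isPreconnected_univ
      (((diff x τ).comp (f := fun z : ℂ => (z, fun i => (A i : ℂ))) (by fun_prop)).differentiableOn)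
      (Set.mem_univ _) (fun r hr => h1 x τ r A hr) (Set.mem_univ N)
  have h3 := eq_zero_of_forall_pos_real
      (D := fun z => G x τ N (fun i => ((A i).re : ℂ) + z * ((A i).im : ℂ))) isOpen_univ
      isPreconnected_univ
      (((diff x τ).comp (f := fun z : ℂ => (N, fun i => ((A i).re : ℂ) + z * ((A i).im : ℂ)))
        (by fun_prop)).differentiableOn)
      (Set.mem_univ _) (fun r _ => by simpa using h2 N (fun i => (A i).re + r * (A i).im))
      (Set.mem_univ Complex.I)
  have hA : (fun i => ((A i).re : ℂ) + Complex.I * ((A i).im : ℂ)) = A := by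
    funext i
    apply Complex.ext <;> simp
  simpa only [hA] using h3

/-! ### The action of `SL₂(ℝ)` -/

/-- The automorphy factor `cτ + d`. -/
def J (g : SL(2, ℝ)) (τ : ℍ) : ℂ := (g 1 0 : ℂ) * τ + (g 1 1 : ℂ)

lemma J_ne_zero (g : SL(2, ℝ)) (τ : ℍ) : J g τ ≠ 0 := by
  refine linear_ne_zero (cd := ![g 1 0, g 1 1]) τ fun h => ?_
  have h0 : g 1 0 = 0 := congrFun h 0
  have h1 : g 1 1 = 0 := congrFun h 1
  simpa [h0, h1] using sl_det g

lemma coe_sl_smul (g : SL(2, ℝ)) (τ : ℍ) :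
    ((g • τ : ℍ) : ℂ) = ((g 0 0 : ℂ) * τ + (g 0 1 : ℂ)) / J g τ := by
  rw [coe_specialLinearGroup_apply]
  rfl

lemma sl_det_complex (g : SL(2, ℝ)) :
    (g 0 0 : ℂ) * (g 1 1 : ℂ) - (g 0 1 : ℂ) * (g 1 0 : ℂ) = 1 := by
  exact_mod_cast sl_det g

lemma J_mul (g h : SL(2, ℝ)) (τ : ℍ) : J (g * h) τ = J g (h • τ) * J h τ := by
  have hJ := J_ne_zero h τ
  rw [J, J, coe_sl_smul]
  field_simp
  simp only [J, sl_mul_apply]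
  push_cast
  ring

lemma J_one (τ : ℍ) : J 1 τ = 1 := by simp [J]

lemma J_inv_smul (g : SL(2, ℝ)) (τ : ℍ) : J g (g⁻¹ • τ) * J g⁻¹ τ = 1 := by
  rw [← J_mul, mul_inv_cancel, J_one]

lemma J_upper (t : ℝ) (τ : ℍ) : J (upper t) τ = 1 := by simp [J]

lemma coe_upper_smul (t : ℝ) (τ : ℍ) : ((upper t • τ : ℍ) : ℂ) = τ + t := by
  simp [coe_sl_smul, J_upper]

lemma im_upper_smul (t : ℝ) (τ : ℍ) : (upper t • τ).im = τ.im := by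
  simpa using congrArg Complex.im (coe_upper_smul t τ)

lemma im_eq (z : ℂ) : (z.im : ℂ) = (z - (starRingEnd ℂ) z) / (2 * Complex.I) := by
  rw [Complex.sub_conj]
  field_simp
  simp [mul_comm]

lemma conj_J (g : SL(2, ℝ)) (τ : ℍ) :
    (starRingEnd ℂ) (J g τ) = J g τ - 2 * Complex.I * (g 1 0 : ℂ) * (τ.im : ℂ) := by
  apply Complex.ext <;> simp [J]
  ring

lemma im_sl_smul (g : SL(2, ℝ)) (τ : ℍ) :
    ((g • τ).im : ℂ) = τ.im / (J g τ * (starRingEnd ℂ) (J g τ)) := by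
  have h1 := J_ne_zero g τ
  have h2 : (starRingEnd ℂ) (J g τ) ≠ 0 := by simpa using h1
  have hd := sl_det_complex g
  rw [← coe_im, ← coe_im, im_eq, im_eq (τ : ℂ), coe_sl_smul]
  simp only [map_div₀, map_add, map_mul, Complex.conj_ofReal]
  field_simp
  simp only [J, map_add, map_mul, Complex.conj_ofReal]
  linear_combination ((τ : ℂ) - (starRingEnd ℂ) (τ : ℂ)) * hd

lemma nu_smul (g : SL(2, ℝ)) (τ : ℍ) :
    nu (g • τ) = J g τ ^ 2 * nu τ + g 1 0 * J g τ / (4 * Real.pi * Complex.I) := by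
  have h1 := J_ne_zero g τ
  have h2 : (starRingEnd ℂ) (J g τ) ≠ 0 := by simpa using h1
  have h3 : (τ.im : ℂ) ≠ 0 := by exact_mod_cast τ.im_pos.ne'
  have h4 : (Real.pi : ℂ) ≠ 0 := by exact_mod_cast Real.pi_ne_zero
  rw [nu, nu, im_sl_smul]
  field_simp
  rw [conj_J]
  linear_combination (-8 * (g 1 0 : ℂ) * τ.im) * Complex.I_sq

lemma alpha_smul (g : SL(2, ℝ)) (x : Fin n → ℂ) (τ : ℍ) (l : Fin n) :
    alpha (fun i => x i / J g τ) (g • τ) l = J g τ * alpha x τ l - g 1 0 * x l := by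
  have h1 := J_ne_zero g τ
  have h2 : (starRingEnd ℂ) (J g τ) ≠ 0 := by simpa using h1
  have h3 : (τ.im : ℂ) ≠ 0 := by exact_mod_cast τ.im_pos.ne'
  rw [alpha, alpha, im_sl_smul, im_eq, im_eq (x l), map_div₀]
  field_simp
  rw [conj_J]
  ring

/-- The factor `(cτ + d)^k e(c x^t L x / (cτ + d))`. -/
def factor (k : ℤ) (L : Matrix (Fin n) (Fin n) ℚ) (g : SL(2, ℝ)) (x : Fin n → ℂ) (τ : ℍ) : ℂ :=
  J g τ ^ k * e (g 1 0 * bil L x x / J g τ)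

lemma e_add (z w : ℂ) : e (z + w) = e z * e w := by
  rw [e, e, e, ← Complex.exp_add]
  ring_nf

lemma e_zero : e 0 = 1 := by simp [e]

lemma e_neg (z : ℂ) : e (-z) = (e z)⁻¹ := by
  rw [e, e, ← Complex.exp_neg]
  ring_nf

lemma e_ne_zero (z : ℂ) : e z ≠ 0 := Complex.exp_ne_zero _

lemma e_int (t : ℤ) : e t = 1 := by
  rw [e, Complex.exp_eq_one_iff]
  exact ⟨t, by ring⟩

lemma bil_smul_smul (L : Matrix (Fin n) (Fin n) ℚ) (a b : ℂ) (x y : Fin n → ℂ) :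
    bil L (fun i => a * x i) (fun i => b * y i) = a * b * bil L x y := by
  simp only [bil, Finset.mul_sum]
  refine Finset.sum_congr rfl fun i _ => Finset.sum_congr rfl fun j _ => ?_
  ring

lemma bil_add_left (L : Matrix (Fin n) (Fin n) ℚ) (x x' y : Fin n → ℂ) :
    bil L (fun i => x i + x' i) y = bil L x y + bil L x' y := by
  simp only [bil, ← Finset.sum_add_distrib]
  refine Finset.sum_congr rfl fun i _ => Finset.sum_congr rfl fun j _ => ?_
  ring

lemma bil_add_right (L : Matrix (Fin n) (Fin n) ℚ) (x y y' : Fin n → ℂ) :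
    bil L x (fun i => y i + y' i) = bil L x y + bil L x y' := by
  simp only [bil, ← Finset.sum_add_distrib]
  refine Finset.sum_congr rfl fun i _ => Finset.sum_congr rfl fun j _ => ?_
  ring

lemma factor_ne_zero (k : ℤ) (L : Matrix (Fin n) (Fin n) ℚ) (g : SL(2, ℝ)) (x : Fin n → ℂ)
    (τ : ℍ) : factor k L g x τ ≠ 0 :=
  mul_ne_zero (zpow_ne_zero _ (J_ne_zero g τ)) (e_ne_zero _)

lemma bil_div_div (L : Matrix (Fin n) (Fin n) ℚ) (x : Fin n → ℂ) (a : ℂ) :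
    bil L (fun i => x i / a) (fun i => x i / a) = bil L x x / a ^ 2 := by
  have := bil_smul_smul L a⁻¹ a⁻¹ x x
  simp only [inv_mul_eq_div] at this
  rw [this]
  ring

/-- The cocycle relation. -/
lemma factor_mul (k : ℤ) (L : Matrix (Fin n) (Fin n) ℚ) (g h : SL(2, ℝ)) (x : Fin n → ℂ)
    (τ : ℍ) : factor k L (g * h) x τ =
      factor k L g (fun i => x i / J h τ) (h • τ) * factor k L h x τ := by
  have h1 := J_ne_zero h τ
  have h2 := J_ne_zero g (h • τ)
  have h3 : ((g * h) 1 0 : ℂ) * J h τ = g 1 0 + h 1 0 * (J g (h • τ) * J h τ) := by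
    rw [← J_mul]
    simp only [J, sl_mul_apply]
    push_cast
    linear_combination (g 1 0 : ℂ) * sl_det_complex h
  have h4 : ((g * h) 1 0 : ℂ) * bil L x x / J (g * h) τ =
      g 1 0 * bil L (fun i => x i / J h τ) (fun i => x i / J h τ) / J g (h • τ) +
        h 1 0 * bil L x x / J h τ := by
    rw [J_mul, bil_div_div]
    field_simp
    linear_combination bil L x x * h3
  rw [factor, h4, e_add, J_mul, mul_zpow, factor, factor]
  ring

/-- Invariance of `Φ` under `g` in weight `k` and index `L`. -/
def IsInvariant (k : ℤ) (L : Matrix (Fin n) (Fin n) ℚ) (Φ : (Fin n → ℂ) → ℍ → ℂ)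
    (g : SL(2, ℝ)) : Prop :=
  ∀ x τ, Φ (fun i => x i / J g τ) (g • τ) = factor k L g x τ * Φ x τ

section

variable {k : ℤ} {L : Matrix (Fin n) (Fin n) ℚ} {Φ : (Fin n → ℂ) → ℍ → ℂ}

lemma IsInvariant.one : IsInvariant k L Φ 1 := by
  intro x τ
  simp [J_one, factor, e_zero]

lemma IsInvariant.mul {g h : SL(2, ℝ)} (hg : IsInvariant k L Φ g) (hh : IsInvariant k L Φ h) :
    IsInvariant k L Φ (g * h) := by
  intro x τ
  have h1 := hg (fun i => x i / J h τ) (h • τ)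
  rw [hh, ← mul_assoc, ← factor_mul, smul_smul] at h1
  rw [← h1, J_mul]
  congr 1
  funext i
  rw [div_div, mul_comm]

lemma IsInvariant.inv {g : SL(2, ℝ)} (hg : IsInvariant k L Φ g) : IsInvariant k L Φ g⁻¹ := by
  intro x τ
  have h1 := hg (fun i => x i / J g⁻¹ τ) (g⁻¹ • τ)
  have h2 : (fun i => x i / J g⁻¹ τ / J g (g⁻¹ • τ)) = x := by
    funext i
    rw [div_div, mul_comm, J_inv_smul, div_one]
  have h3 := factor_mul k L g g⁻¹ x τ
  rw [mul_inv_cancel] at h3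
  have h4 : factor k L 1 x τ = 1 := by simp [J_one, factor, e_zero]
  rw [h2, smul_inv_smul] at h1
  rw [h1, ← mul_assoc, mul_comm (factor k L g⁻¹ x τ), ← h3, h4, one_mul]

/-- The subgroup of `SL₂(ℝ)` under which `Φ` is invariant. -/
def invariance (k : ℤ) (L : Matrix (Fin n) (Fin n) ℚ) (Φ : (Fin n → ℂ) → ℍ → ℂ) :
    Subgroup SL(2, ℝ) where
  carrier := {g | IsInvariant k L Φ g}
  mul_mem' hg hh := hg.mul hh
  one_mem' := IsInvariant.one
  inv_mem' hg := hg.inv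

lemma continuous_entry (i j : Fin 2) : Continuous fun g : SL(2, ℝ) => g i j :=
  (continuous_apply_apply i j).comp continuous_subtype_val

lemma continuous_J (τ : ℍ) : Continuous fun g : SL(2, ℝ) => J g τ := by
  have h1 := continuous_entry 1 0
  have h2 := continuous_entry 1 1
  unfold J
  fun_prop

lemma continuous_e : Continuous e := by
  unfold e
  fun_prop

lemma isClosed_invariance (hΦ : Continuous fun p : (Fin n → ℂ) × ℍ => Φ p.1 p.2) :
    IsClosed (invariance k L Φ : Set SL(2, ℝ)) := by
  have : (invariance k L Φ : Set SL(2, ℝ)) = ⋂ (x : Fin n → ℂ), ⋂ (τ : ℍ),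
      {g | Φ (fun i => x i / J g τ) (g • τ) = factor k L g x τ * Φ x τ} := by
    ext g
    simp [invariance, IsInvariant]
  rw [this]
  refine isClosed_iInter fun x => isClosed_iInter fun τ => isClosed_eq ?_ ?_
  · refine hΦ.comp (f := fun g : SL(2, ℝ) => ((fun i => x i / J g τ), g • τ))
      (Continuous.prodMk (continuous_pi fun i =>
        continuous_const.div (continuous_J τ) fun g => J_ne_zero g τ) ?_)
    exact continuous_id.smul continuous_const
  · refine Continuous.mul (Continuous.mul ?_ (continuous_e.comp ?_)) continuous_const
    · exact (continuous_J τ).zpow₀ k fun g => Or.inl (J_ne_zero g τ)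
    · have h1 := continuous_entry 1 0
      exact Continuous.div (by fun_prop) (continuous_J τ) fun g => J_ne_zero g τ

lemma isInvariant_of_jacSlash_eq {γ : SL(2, ℤ)} (h : jacSlash k L γ Φ = Φ) :
    IsInvariant k L Φ (Matrix.SpecialLinearGroup.map (n := Fin 2) (Int.castRingHom ℝ) γ) := by
  intro x τ
  set g : SL(2, ℝ) := Matrix.SpecialLinearGroup.map (n := Fin 2) (Int.castRingHom ℝ) γ with hg
  have hJ : (γ 1 0 : ℂ) * (τ : ℂ) + (γ 1 1 : ℂ) = J g τ := by
    simp [J, hg, map_int_apply]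
  have h10 : (γ 1 0 : ℂ) = (g 1 0 : ℂ) := by simp [hg, map_int_apply]
  have hs : γ • τ = g • τ := by
    apply UpperHalfPlane.ext
    rw [coe_specialLinearGroup_apply, coe_specialLinearGroup_apply]
    simp [hg]
  have h1 := congrFun (congrFun h x) τ
  simp only [jacSlash, hJ] at h1
  simp only [h10, hs, e_neg, zpow_neg] at h1
  have h2 : J g τ ^ k ≠ 0 := zpow_ne_zero _ (J_ne_zero g τ)
  have h3 := e_ne_zero (g 1 0 * bil L x x / J g τ)
  rw [factor, ← h1]
  field_simp

end

/-! ### Transformation laws of the polynomial extension -/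

section

variable {k : ℤ} {L : Matrix (Fin n) (Fin n) ℚ} {P : (Fin n → ℂ) → ℍ → ℂ → (Fin n → ℂ) → ℂ}

/-- Invariance of an almost-holomorphic function is an identity between polynomials in `ν` and `α`,
hence it holds for independent variables `N` and `A`. -/
lemma IsHolPoly.smul_eq (hP : IsHolPoly P) {g : SL(2, ℝ)}
    (hg : IsInvariant k L (fun x τ => P x τ (nu τ) (alpha x τ)) g)
    (x : Fin n → ℂ) (τ : ℍ) (N : ℂ) (A : Fin n → ℂ) :
    P (fun i => x i / J g τ) (g • τ)
        (J g τ ^ 2 * N + g 1 0 * J g τ / (4 * Real.pi * Complex.I))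
        (fun l => J g τ * A l - g 1 0 * x l) = factor k L g x τ * P x τ N A := by
  refine sub_eq_zero.1 (eq_zero_of_eq_zero_nu_alpha
    (G := fun x τ N A => P (fun i => x i / J g τ) (g • τ)
      (J g τ ^ 2 * N + g 1 0 * J g τ / (4 * Real.pi * Complex.I))
      (fun l => J g τ * A l - g 1 0 * x l) - factor k L g x τ * P x τ N A)
    (fun N A => ?_) (fun x τ => ?_) (fun x τ => ?_) x τ N A)
  · set j : ℂ → ℂ := fun z => (g 1 0 : ℂ) * z + (g 1 1 : ℂ) with hj
    have hJ : ∀ z : ℂ, 0 < z.im → J g (ofComplex z) = j z := fun z hz => by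
      simp only [J, ofComplex_apply_of_im_pos hz, hj]
    have hj0 : ∀ p ∈ {p : (Fin n → ℂ) × ℂ | 0 < p.2.im}, j p.2 ≠ 0 := fun p hp => by
      rw [← hJ p.2 hp]
      exact J_ne_zero _ _
    have hg' : ∀ z : ℂ, 0 < z.im →
        ((g • ofComplex z : ℍ) : ℂ) = ((g 0 0 : ℂ) * z + (g 0 1 : ℂ)) / j z := fun z hz => by
      rw [coe_sl_smul, hJ z hz, ofComplex_apply_of_im_pos hz]
    have hbil : Differentiable ℂ fun p : (Fin n → ℂ) × ℂ => bil L p.1 p.1 := by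
      unfold bil
      fun_prop
    have hjd : Differentiable ℂ fun p : (Fin n → ℂ) × ℂ => j p.2 := by fun_prop
    have hjd' := hjd.differentiableOn (s := {p : (Fin n → ℂ) × ℂ | 0 < p.2.im})
    have hinv : DifferentiableOn ℂ (fun p : (Fin n → ℂ) × ℂ => (j p.2)⁻¹) {p | 0 < p.2.im} :=
      hjd'.inv hj0
    have h1 : DifferentiableOn ℂ (fun p : (Fin n → ℂ) × ℂ =>
        P (fun i => p.1 i / j p.2) (ofComplex (((g 0 0 : ℂ) * p.2 + (g 0 1 : ℂ)) / j p.2))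
          (j p.2 ^ 2 * N + g 1 0 * j p.2 / (4 * Real.pi * Complex.I))
          (fun l => j p.2 * A l - g 1 0 * p.1 l)) {p | 0 < p.2.im} := by
      refine hP.comp (differentiableOn_pi.2 fun i => ?_) ?_ ?_ ?_ fun p hp => ?_
      · simp only [div_eq_mul_inv]
        exact DifferentiableOn.mul (by fun_prop) hinv
      · simp only [div_eq_mul_inv]
        exact DifferentiableOn.mul (by fun_prop) hinv
      · simp only [div_eq_mul_inv]
        fun_prop
      · fun_prop
      · rw [← hg' p.2 hp]
        exact (g • ofComplex p.2).im_pos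
    have h2 : DifferentiableOn ℂ (fun p : (Fin n → ℂ) × ℂ =>
        j p.2 ^ k * e (g 1 0 * bil L p.1 p.1 / j p.2)) {p | 0 < p.2.im} := by
      refine DifferentiableOn.mul (fun p hp => ?_) ?_
      · exact (hjd' p hp).zpow (Or.inl (hj0 p hp))
      · unfold e
        refine DifferentiableOn.cexp (DifferentiableOn.const_mul ?_ _)
        simp only [div_eq_mul_inv]
        exact (hbil.differentiableOn.const_mul _).mul hinv
    refine (h1.sub (h2.mul (hP.jacHol N A))).congr fun p hp => ?_
    have hp' : ofComplex (((g 0 0 : ℂ) * p.2 + (g 0 1 : ℂ)) / j p.2) = g • ofComplex p.2 := by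
      rw [← hg' p.2 hp, ofComplex_apply]
    simp only [factor, hJ p.2 hp, Pi.sub_apply, Pi.mul_apply, hp']
  · have hd := hP.differentiable
    refine Differentiable.sub ?_ ((hd x τ).const_mul _)
    exact (hd (fun i => x i / J g τ) (g • τ)).comp
      (f := fun p : ℂ × (Fin n → ℂ) =>
        (J g τ ^ 2 * p.1 + g 1 0 * J g τ / (4 * Real.pi * Complex.I),
          fun l => J g τ * p.2 l - g 1 0 * x l)) (by fun_prop)
  · have h := hg x τ
    simp only [nu_smul, funext (alpha_smul g x τ)] at h
    exact sub_eq_zero.2 h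

/-- Quasi-periodicity of `Φ` under the lattice `ℤⁿ ⊕ ℤⁿ` in index `L`. -/
def IsElliptic (L : Matrix (Fin n) (Fin n) ℚ) (Φ : (Fin n → ℂ) → ℍ → ℂ) : Prop :=
  ∀ (lam mu : Fin n → ℤ) (x : Fin n → ℂ) (τ : ℍ),
    Φ (fun i => x i + (lam i : ℂ) * (τ : ℂ) + (mu i : ℂ)) τ =
      e (-(bil L (fun i => (lam i : ℂ)) (fun i => (lam i : ℂ)) * (τ : ℂ))
          - 2 * bil L (fun i => (lam i : ℂ)) x) * Φ x τ

lemma alpha_add (x : Fin n → ℂ) (τ : ℍ) (lam mu : Fin n → ℤ) (l : Fin n) :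
    alpha (fun i => x i + (lam i : ℂ) * (τ : ℂ) + (mu i : ℂ)) τ l = alpha x τ l + lam l := by
  have h : (τ.im : ℂ) ≠ 0 := by exact_mod_cast τ.im_pos.ne'
  rw [alpha, alpha]
  field_simp
  simp

/-- The analogue of `IsHolPoly.smul_eq` for the lattice translations. -/
lemma IsHolPoly.add_eq (hP : IsHolPoly P)
    (hell : IsElliptic L fun x τ => P x τ (nu τ) (alpha x τ)) (lam mu : Fin n → ℤ)
    (x : Fin n → ℂ) (τ : ℍ) (N : ℂ) (A : Fin n → ℂ) :
    P (fun i => x i + (lam i : ℂ) * (τ : ℂ) + (mu i : ℂ)) τ N (fun l => A l + lam l) =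
      e (-(bil L (fun i => (lam i : ℂ)) (fun i => (lam i : ℂ)) * (τ : ℂ))
          - 2 * bil L (fun i => (lam i : ℂ)) x) * P x τ N A := by
  refine sub_eq_zero.1 (eq_zero_of_eq_zero_nu_alpha
    (G := fun x τ N A =>
      P (fun i => x i + (lam i : ℂ) * (τ : ℂ) + (mu i : ℂ)) τ N (fun l => A l + lam l) -
      e (-(bil L (fun i => (lam i : ℂ)) (fun i => (lam i : ℂ)) * (τ : ℂ))
          - 2 * bil L (fun i => (lam i : ℂ)) x) * P x τ N A)
    (fun N A => ?_) (fun x τ => ?_) (fun x τ => ?_) x τ N A)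
  · have hbil : Differentiable ℂ fun p : (Fin n → ℂ) × ℂ => bil L (fun i => (lam i : ℂ)) p.1 := by
      unfold bil
      fun_prop
    have h1 : DifferentiableOn ℂ (fun p : (Fin n → ℂ) × ℂ =>
        P (fun i => p.1 i + (lam i : ℂ) * p.2 + (mu i : ℂ)) (ofComplex p.2) N
          (fun l => A l + lam l)) {p | 0 < p.2.im} :=
      hP.comp (by fun_prop) (by fun_prop) (by fun_prop) (by fun_prop) fun p hp => hp
    have h2 : DifferentiableOn ℂ (fun p : (Fin n → ℂ) × ℂ =>
        e (-(bil L (fun i => (lam i : ℂ)) (fun i => (lam i : ℂ)) * p.2)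
          - 2 * bil L (fun i => (lam i : ℂ)) p.1)) {p | 0 < p.2.im} := by
      unfold e
      fun_prop
    refine (h1.sub (h2.mul (hP.jacHol N A))).congr fun p hp => ?_
    have hp' : ((ofComplex p.2 : ℍ) : ℂ) = p.2 := by rw [ofComplex_apply_of_im_pos hp]
    simp only [hp', Pi.sub_apply, Pi.mul_apply]
  · have hd := hP.differentiable
    refine Differentiable.sub ?_ ((hd x τ).const_mul _)
    exact (hd _ τ).comp (f := fun p : ℂ × (Fin n → ℂ) => (p.1, fun l => p.2 l + (lam l : ℂ)))
      (by fun_prop)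
  · have h := hell lam mu x τ
    simp only [funext (alpha_add x τ lam mu)] at h
    exact sub_eq_zero.2 h

/-! ### The short translation preserves the almost-holomorphic form -/

/-- Periodicity of the constant term under `τ ↦ τ + 1/m` extends to the coefficients of the
monomials in `α`: the lattice translations by multiples of `m` commute with `τ ↦ τ + 1/m` up to the
lattice, and move `A = 0` to a Zariski dense set. -/
lemma IsHolPoly.upper_smul_eq_of_nu_zero (hP : IsHolPoly P)
    (hell : IsElliptic L fun x τ => P x τ (nu τ) (alpha x τ))
    (hL : ∀ v : Fin n → ℤ, ∃ t : ℤ, bil L (fun i => (v i : ℂ)) (fun i => (v i : ℂ)) = t)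
    {m : ℕ} (hm : m ≠ 0)
    (h0 : ∀ x τ, P x (upper (1 / (m : ℝ)) • τ) 0 0 = P x τ 0 0)
    (x : Fin n → ℂ) (τ : ℍ) (A : Fin n → ℂ) :
    P x (upper (1 / (m : ℝ)) • τ) 0 A = P x τ 0 A := by
  have hmC : (m : ℂ) ≠ 0 := by exact_mod_cast hm
  have hlat : ∀ v : Fin n → ℤ, P x (upper (1 / (m : ℝ)) • τ) 0 (fun l => m * v l) =
      P x τ 0 (fun l => m * v l) := by
    intro v
    obtain ⟨t, ht⟩ := hL v
    have h1 := hP.add_eq hell (fun i => m * v i) 0 (fun i => x i - m * v i * τ) τ 0 0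
    have h2 := hP.add_eq hell (fun i => m * v i) (fun i => -v i) (fun i => x i - m * v i * τ)
      (upper (1 / (m : ℝ)) • τ) 0 0
    rw [h0] at h2
    have hx1 : (fun i => x i - m * v i * τ + ((m * v i : ℤ) : ℂ) * τ + ((0 : Fin n → ℤ) i : ℂ))
        = x := by
      funext i
      push_cast [Pi.zero_apply]
      ring
    have hx2 : (fun i => x i - m * v i * τ +
        ((m * v i : ℤ) : ℂ) * (upper (1 / (m : ℝ)) • τ : ℍ) + ((-v i : ℤ) : ℂ)) = x := by
      funext i
      rw [coe_upper_smul]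
      push_cast
      field_simp
      ring
    have hA : (fun l => (0 : Fin n → ℂ) l + ((m * v l : ℤ) : ℂ)) = fun l => m * (v l : ℂ) := by
      funext l
      simp
    rw [hx1, hA] at h1
    rw [hx2, hA] at h2
    rw [h1, h2]
    congr 1
    have hb : bil L (fun i => ((m * v i : ℤ) : ℂ)) (fun i => ((m * v i : ℤ) : ℂ)) =
        m * m * t := by
      rw [← ht, ← bil_smul_smul]
      push_cast
      rfl
    rw [hb, coe_upper_smul, show ∀ y : ℂ, -(m * m * t * ((τ : ℂ) + ((1 / (m : ℝ) : ℝ) : ℂ))) - y =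
      (-(m * m * t * (τ : ℂ)) - y) + ((-(m * t) : ℤ) : ℂ) by
        intro y; push_cast; field_simp; ring, e_add, e_int, mul_one]
  obtain ⟨q₁, hq₁⟩ := hP.polynomial_right x (upper (1 / (m : ℝ)) • τ) 0
  obtain ⟨q₂, hq₂⟩ := hP.polynomial_right x τ 0
  rw [hq₁, hq₂]
  congr 1
  refine MvPolynomial.funext_set (fun _ => Set.range fun z : ℤ => (m : ℂ) * z)
    (fun _ => Set.infinite_range_of_injective fun a b hab => ?_) fun A hA => ?_
  · simpa [hmC] using hab
  · choose v hv using fun i => hA i (Set.mem_univ i)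
    rw [← hq₁, ← hq₂, ← funext hv]
    exact hlat v

/-- Periodicity of the constant term under `τ ↦ τ + 1/m` extends to the whole form: the matrices
`(1 0; c 1)` with `2m² ∣ c` stay in `Γ₀(2)` after conjugation by `(1 1/m; 0 1)`, and move `N = 0`
to infinitely many points. -/
lemma IsHolPoly.upper_smul_eq (hP : IsHolPoly P)
    (hmod : ∀ g ∈ (CongruenceSubgroup.Gamma0 2).map
      (Matrix.SpecialLinearGroup.map (n := Fin 2) (Int.castRingHom ℝ)),
        IsInvariant k L (fun x τ => P x τ (nu τ) (alpha x τ)) g)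
    (hell : IsElliptic L fun x τ => P x τ (nu τ) (alpha x τ))
    (hL : ∀ v : Fin n → ℤ, ∃ t : ℤ, bil L (fun i => (v i : ℂ)) (fun i => (v i : ℂ)) = t)
    {m : ℕ} (hm : m ≠ 0)
    (h0 : ∀ x τ, P x (upper (1 / (m : ℝ)) • τ) 0 0 = P x τ 0 0)
    (x : Fin n → ℂ) (τ : ℍ) (N : ℂ) (A : Fin n → ℂ) :
    P x (upper (1 / (m : ℝ)) • τ) N A = P x τ N A := by
  set T := upper (1 / (m : ℝ)) with hT
  have hpi : (4 * Real.pi * Complex.I : ℂ) ≠ 0 := by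
    have : (Real.pi : ℂ) ≠ 0 := by exact_mod_cast Real.pi_ne_zero
    simp [this]
  let g : ℤ → SL(2, ℝ) := fun r => lower (2 * (m ^ 2 * r : ℤ))
  have hg10 : ∀ r, g r 1 0 = 2 * m ^ 2 * r := fun r => by simp [g, mul_assoc]
  have hpt : ∀ r : ℤ,
      P x (T • τ) (g r 1 0 * J (g r) ((g r)⁻¹ • τ) / (4 * Real.pi * Complex.I)) A =
        P x τ (g r 1 0 * J (g r) ((g r)⁻¹ • τ) / (4 * Real.pi * Complex.I)) A := by
    intro r
    set c := g r 1 0 with hc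
    set σ := (g r)⁻¹ • τ with hσ
    have hJ := J_ne_zero (g r) σ
    set y : Fin n → ℂ := fun i => J (g r) σ * x i with hy
    set B : Fin n → ℂ := fun l => (A l + c * y l) / J (g r) σ with hB
    have hy' : (fun i => y i / J (g r) σ) = x := by
      funext i
      rw [hy]
      field_simp
    have hB' : (fun l => J (g r) σ * B l - c * y l) = A := by
      funext l
      rw [hB]
      field_simp
      ring
    have h1 := hP.smul_eq (hmod _ (lower_mem_map_Gamma0 (m ^ 2 * r))) y σ 0 B
    have hmem : T * g r * T⁻¹ ∈ (CongruenceSubgroup.Gamma0 2).map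
        (Matrix.SpecialLinearGroup.map (n := Fin 2) (Int.castRingHom ℝ)) := by
      rw [hT, ← upper_neg]
      refine mem_map_Gamma0 (a := 1 + 2 * m * r) (b := -2 * r) (c := m ^ 2 * r)
        (d := 1 - 2 * m * r) ?_ ?_ ?_ ?_ <;> simp [sl_mul_apply, g] <;> field_simp <;> ring
    have h2 := hP.smul_eq (hmod _ hmem) y (T • σ) 0 B
    have hTg : (T * g r * T⁻¹) • T • σ = T • τ := by
      rw [smul_smul, inv_mul_cancel_right, mul_smul, hσ, smul_inv_smul]
    have hJ' : J (T * g r * T⁻¹) (T • σ) = J (g r) σ := by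
      have h := J_mul (T * g r * T⁻¹) T σ
      rw [inv_mul_cancel_right, J_mul, J_upper, J_upper, one_mul, mul_one] at h
      exact h.symm
    have h10 : (T * g r * T⁻¹) 1 0 = c := by
      rw [hT, ← upper_neg]
      simp [sl_mul_apply, hc]
    have h1' : P (fun i => y i / J (g r) σ) (g r • σ)
        (J (g r) σ ^ 2 * 0 + c * J (g r) σ / (4 * Real.pi * Complex.I))
        (fun l => J (g r) σ * B l - c * y l) = factor k L (g r) y σ * P y σ 0 B := h1
    rw [hy', hB', mul_zero, zero_add, hσ, smul_inv_smul, ← hσ] at h1'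
    rw [hTg, hJ', h10, hy', hB', mul_zero, zero_add,
      hP.upper_smul_eq_of_nu_zero hell hL hm h0, factor, hJ', h10] at h2
    rw [h2, h1', factor]
  obtain ⟨q₁, hq₁⟩ := hP.polynomial_left x (T • τ) A
  obtain ⟨q₂, hq₂⟩ := hP.polynomial_left x τ A
  rw [hq₁, hq₂]
  congr 1
  refine Polynomial.eq_of_infinite_eval_eq _ _ (Set.Infinite.mono (s := Set.range fun r : ℤ =>
    (g r 1 0 * J (g r) ((g r)⁻¹ • τ) / (4 * Real.pi * Complex.I) : ℂ)) ?_ ?_)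
  · rintro _ ⟨r, rfl⟩
    change q₁.eval _ = q₂.eval _
    rw [← hq₁, ← hq₂]
    exact hpt r
  · refine Set.infinite_range_of_injective fun r s hrs => ?_
    have hginv : ∀ r, J (g r) ((g r)⁻¹ • τ) * (1 - g r 1 0 * τ) = 1 := by
      intro r
      have hi : (g r)⁻¹ = lower (-(2 * (m ^ 2 * r : ℤ))) := by
        rw [inv_eq_iff_mul_eq_one]
        apply sl_ext <;> simp [sl_mul_apply, g]
      have hJi : J (g r)⁻¹ τ = 1 - g r 1 0 * τ := by
        rw [hi]
        simp [J, g]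
        ring
      rw [← hJi, J_inv_smul]
    -- `c J = c / (1 - c τ)` determines `c`
    have hrs' : (g r 1 0 : ℂ) * J (g r) ((g r)⁻¹ • τ) = g s 1 0 * J (g s) ((g s)⁻¹ • τ) := by
      have := congrArg (· * (4 * Real.pi * Complex.I : ℂ)) hrs
      simpa only [div_mul_cancel₀ _ hpi] using this
    have hc : (g r 1 0 : ℂ) = g s 1 0 := by
      have h1 := hginv r
      have h2 := hginv s
      linear_combination (1 - (g r 1 0 : ℂ) * τ) * (1 - (g s 1 0 : ℂ) * τ) * hrs' -
        (g r 1 0 : ℂ) * (1 - (g s 1 0 : ℂ) * τ) * h1 + (g s 1 0 : ℂ) * (1 - (g r 1 0 : ℂ) * τ) * h2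
    have hc' : (2 * m ^ 2 * r : ℝ) = 2 * m ^ 2 * s := by
      rw [← hg10, ← hg10]
      exact_mod_cast hc
    have : (r : ℝ) = s := mul_left_cancel₀ (by positivity) hc'
    exact_mod_cast this

end

/-! ### Functions invariant under the full group `SL₂(ℝ)` -/

section

variable {k : ℤ} {L : Matrix (Fin n) (Fin n) ℚ} {Φ : (Fin n → ℂ) → ℍ → ℂ}

/-- The diagonal matrices conjugate the integral translations of `x` to all real ones. -/
lemma add_real_of_isInvariant (hinv : ∀ g, IsInvariant k L Φ g)
    (hper : ∀ (mu : Fin n → ℤ) (x : Fin n → ℂ) (τ : ℍ),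
      Φ (fun i => x i + (mu i : ℂ)) τ = Φ x τ)
    (v : Fin n → ℝ) (x : Fin n → ℂ) (τ : ℍ) : Φ (fun i => x i + (v i : ℂ)) τ = Φ x τ := by
  let S : AddSubmonoid (Fin n → ℝ) :=
    { carrier := {v | ∀ x τ, Φ (fun i => x i + (v i : ℂ)) τ = Φ x τ}
      add_mem' := by
        intro v w hv hw x τ
        refine Eq.trans ?_ ((hw (fun i => x i + (v i : ℂ)) τ).trans (hv x τ))
        simp [add_assoc]
      zero_mem' := by intro x τ; simp }
  have hS : ∀ (i : Fin n) (s : ℝ), Pi.single i s ∈ S := by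
    intro i s x τ
    rcases eq_or_ne s 0 with rfl | hs
    · simp
    have hsC : (s : ℂ) ≠ 0 := by exact_mod_cast hs
    let g : SL(2, ℝ) := ⟨!![s⁻¹, 0; 0, s], by simp [Matrix.det_fin_two_of, hs]⟩
    have hJ : J g τ = s := by simp [J, g]
    have hfac : ∀ y, factor k L g y τ = factor k L g 0 τ := by
      intro y
      simp [factor, g]
    have h1 := hinv g x τ
    have h2 := hinv g (fun j => x j + ((Pi.single i s : Fin n → ℝ) j : ℂ)) τ
    rw [hfac, hJ] at h1 h2
    have h3 := hper (Pi.single i 1) (fun j => x j / s) (g • τ)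
    refine mul_left_cancel₀ (factor_ne_zero k L g 0 τ) ?_
    rw [← h1, ← h2, ← h3]
    congr 1
    funext j
    rcases eq_or_ne j i with rfl | hj
    · simp
      field_simp
    · simp [hj]
  have hv : v ∈ S := by
    rw [← Finset.univ_sum_single v]
    exact S.sum_mem fun i _ => hS i (v i)
  exact hv x τ

/-- The inversion turns the real translations of `x` into translations by real multiples
of `τ`. -/
lemma add_mul_of_isInvariant (hinv : ∀ g, IsInvariant k L Φ g)
    (hreal : ∀ (v : Fin n → ℝ) (x : Fin n → ℂ) (τ : ℍ),
      Φ (fun i => x i + (v i : ℂ)) τ = Φ x τ)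
    (v : Fin n → ℝ) (x : Fin n → ℂ) (τ : ℍ) :
    Φ (fun i => x i + (v i : ℂ) * τ) τ =
      e (-(bil L (fun i => (v i : ℂ)) (fun i => (v i : ℂ)) * τ + bil L (fun i => (v i : ℂ)) x +
        bil L x (fun i => (v i : ℂ)))) * Φ x τ := by
  let g : SL(2, ℝ) := ⟨!![0, -1; 1, 0], by simp [Matrix.det_fin_two_of]⟩
  have hτ : (τ : ℂ) ≠ 0 := τ.ne_zero
  have hJ : J g τ = τ := by simp [J, g]
  have h10 : (g 1 0 : ℂ) = 1 := by simp [g]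
  have h1 := hinv g x τ
  have h2 := hinv g (fun i => x i + (v i : ℂ) * τ) τ
  have h3 : (fun i => (x i + (v i : ℂ) * τ) / τ) = fun i => x i / τ + (v i : ℂ) := by
    funext i
    field_simp
  rw [hJ, h3, hreal, ← hJ, h1] at h2
  have h4 : bil L (fun i => x i + (v i : ℂ) * τ) (fun i => x i + (v i : ℂ) * τ) / (τ : ℂ) =
      bil L x x / τ + (bil L (fun i => (v i : ℂ)) (fun i => (v i : ℂ)) * τ +
        bil L (fun i => (v i : ℂ)) x + bil L x (fun i => (v i : ℂ))) := by
    have e1 := bil_smul_smul L τ τ (fun i => (v i : ℂ)) (fun i => (v i : ℂ))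
    have e2 := bil_smul_smul L τ 1 (fun i => (v i : ℂ)) x
    have e3 := bil_smul_smul L 1 τ x (fun i => (v i : ℂ))
    simp only [one_mul] at e2 e3
    rw [bil_add_left, bil_add_right, bil_add_right]
    simp only [mul_comm _ (τ : ℂ)] at e1 e2 e3 ⊢
    rw [e1, e2, e3]
    field_simp
    ring
  simp only [factor, hJ, h10, one_mul, h4] at h2
  rw [e_add] at h2
  have h5 : (τ : ℂ) ^ k ≠ 0 := zpow_ne_zero _ hτ
  have h6 := e_ne_zero (bil L x x / τ)
  rw [e_neg]
  rw [eq_inv_mul_iff_mul_eq₀ (e_ne_zero _)]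
  refine mul_left_cancel₀ (mul_ne_zero h5 h6) ?_
  linear_combination -h2

lemma e_neg_half : e (-(1 / 2)) = -1 := by
  rw [e, show 2 * (Real.pi : ℂ) * Complex.I * -(1 / 2) = -(Real.pi * Complex.I) by ring,
    Complex.exp_neg, Complex.exp_pi_mul_I]
  norm_num

/-- The translations of `x` by real vectors and by real multiples of `τ` commute, whereas the
factors they produce do so only if `L = 0`. -/
lemma index_eq_zero_of_ne_zero (hL : L.IsSymm)
    (hreal : ∀ (v : Fin n → ℝ) (x : Fin n → ℂ) (τ : ℍ),
      Φ (fun i => x i + (v i : ℂ)) τ = Φ x τ)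
    (hmul : ∀ (v : Fin n → ℝ) (x : Fin n → ℂ) (τ : ℍ),
      Φ (fun i => x i + (v i : ℂ) * τ) τ =
        e (-(bil L (fun i => (v i : ℂ)) (fun i => (v i : ℂ)) * τ + bil L (fun i => (v i : ℂ)) x +
          bil L x (fun i => (v i : ℂ)))) * Φ x τ)
    {x : Fin n → ℂ} {τ : ℍ} (h : Φ x τ ≠ 0) : L = 0 := by
  have hcomm : ∀ v w : Fin n → ℝ, e (-(bil L (fun i => (v i : ℂ)) (fun i => (w i : ℂ)) +
      bil L (fun i => (w i : ℂ)) (fun i => (v i : ℂ)))) = 1 := by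
    intro v w
    have h1 := hmul v (fun i => x i + (w i : ℂ)) τ
    have h2 := hmul v x τ
    rw [hreal, bil_add_left, bil_add_right,
      show (fun i => x i + (w i : ℂ) + (v i : ℂ) * τ) = fun i => x i + (v i : ℂ) * τ + (w i : ℂ)
        by funext i; ring, hreal, h2] at h1
    have h3 := mul_right_cancel₀ h h1
    refine mul_left_cancel₀ (e_ne_zero (-(bil L (fun i => (v i : ℂ)) (fun i => (v i : ℂ)) * τ +
      bil L (fun i => (v i : ℂ)) x + bil L x (fun i => (v i : ℂ))))) ?_
    rw [← e_add, mul_one, h3]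
    congr 1
    ring
  ext i j
  by_contra hij
  have hij' : (L i j : ℂ) ≠ 0 := by exact_mod_cast hij
  have hsingle : ∀ (a b : Fin n) (s t : ℝ),
      bil L (fun i => ((Pi.single a s : Fin n → ℝ) i : ℂ))
        (fun i => ((Pi.single b t : Fin n → ℝ) i : ℂ)) = s * L a b * t := by
    intro a b s t
    rw [bil, Finset.sum_eq_single a, Finset.sum_eq_single b]
    · simp
    · intro c _ hc; simp [hc]
    · simp
    · intro c _ hc; simp [hc]
    · simp
  have h1 := hcomm (Pi.single i (1 / (4 * L i j : ℝ))) (Pi.single j 1)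
  rw [hsingle, hsingle, hL.apply i j] at h1
  have h2 : (((1 / (4 * L i j : ℝ) : ℝ) : ℂ) * L i j * ((1 : ℝ) : ℂ) +
      ((1 : ℝ) : ℂ) * L i j * ((1 / (4 * L i j : ℝ) : ℝ) : ℂ)) = 1 / 2 := by
    push_cast
    field_simp
    norm_num
  rw [h2, e_neg_half] at h1
  norm_num at h1

/-- The rotation by `π / k` fixes `i` and has automorphy factor `-1` in weight `k`. -/
lemma apply_I_eq_zero (hinv : ∀ g, IsInvariant k L Φ g) (hk : k ≠ 0) : Φ 0 I = 0 := by
  set θ : ℝ := Real.pi / k with hθ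
  let g : SL(2, ℝ) := ⟨!![Real.cos θ, -Real.sin θ; Real.sin θ, Real.cos θ], by
    rw [Matrix.det_fin_two_of]; linear_combination Real.sin_sq_add_cos_sq θ⟩
  have hJ : J g I = Complex.exp (θ * Complex.I) := by
    rw [Complex.exp_mul_I]
    simp [J, g]
    ring
  have hJ0 := J_ne_zero g I
  have hgI : g • I = I := by
    apply UpperHalfPlane.ext
    rw [coe_sl_smul, div_eq_iff hJ0]
    simp [J, g]
    linear_combination -Complex.sin θ * Complex.I_sq
  have hJk : J g I ^ k = -1 := by
    have hkC : (k : ℂ) ≠ 0 := by exact_mod_cast hk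
    rw [hJ, ← Complex.exp_int_mul, ← Complex.exp_pi_mul_I, hθ]
    congr 1
    push_cast
    field_simp
  have h := hinv g 0 I
  have h0 : (fun i => (0 : Fin n → ℂ) i / J g I) = 0 := by
    funext i
    simp
  rw [h0, hgI, factor, hJk, show bil L 0 0 = 0 by simp [bil], mul_zero, zero_div, e_zero] at h
  linear_combination h / 2

/-- A function of weight `k` and index `L` invariant under `SL₂(ℝ)` and the lattice is constant,
and zero unless `k = 0` and `L = 0`. -/
lemma exists_eq_const_of_isInvariant (hL : L.IsSymm) (hinv : ∀ g, IsInvariant k L Φ g)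
    (hper : ∀ (mu : Fin n → ℤ) (x : Fin n → ℂ) (τ : ℍ),
      Φ (fun i => x i + (mu i : ℂ)) τ = Φ x τ) :
    ∃ C : ℂ, (L ≠ 0 ∨ k ≠ 0 → C = 0) ∧ ∀ x τ, Φ x τ = C := by
  have hreal := add_real_of_isInvariant hinv hper
  have hmul := add_mul_of_isInvariant hinv hreal
  by_cases hL0 : L = 0
  · subst hL0
    have hbil : ∀ x y : Fin n → ℂ, bil 0 x y = 0 := fun x y => by simp [bil]
    have hzero : ∀ x τ, Φ x τ = Φ 0 τ := by
      intro x τ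
      have h1 := hreal (fun i => (x i).re - (x i).im / τ.im * τ.re)
        (fun i => (0 : Fin n → ℂ) i + (((x i).im / τ.im : ℝ) : ℂ) * τ) τ
      rw [hmul] at h1
      simp only [hbil, zero_mul, add_zero, neg_zero, e_zero, one_mul] at h1
      rw [← h1]
      congr 1
      funext i
      apply Complex.ext
      · simp
      · simp
        field_simp
    have htrans : ∀ τ, ∃ g : SL(2, ℝ), Φ 0 τ = J g I ^ k * Φ 0 I := by
      intro τ
      obtain ⟨g, rfl⟩ := MulAction.exists_smul_eq SL(2, ℝ) I τ
      refine ⟨g, ?_⟩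
      have h := hinv g 0 I
      rw [hzero, factor, hbil, mul_zero, zero_div, e_zero, mul_one] at h
      exact h
    refine ⟨Φ 0 I, fun h => apply_I_eq_zero hinv (h.resolve_left fun h => h rfl), fun x τ => ?_⟩
    obtain ⟨g, hg⟩ := htrans τ
    rw [hzero, hg]
    by_cases hk : k = 0
    · simp [hk]
    · simp [apply_I_eq_zero hinv hk]
  · refine ⟨0, fun _ => rfl, fun x τ => ?_⟩
    by_contra h
    exact hL0 (index_eq_zero_of_ne_zero hL hreal hmul h)

end

/-! ### Quasi-Jacobi and quasi-modular forms -/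

/-- The rigidity statement common to quasi-modular forms (`n = 0`) and quasi-Jacobi forms. -/
theorem exists_eq_const_of_periodic {m : ℕ} (hm : 2 < m) {k : ℤ} {L : Matrix (Fin n) (Fin n) ℚ}
    {P : (Fin n → ℂ) → ℍ → ℂ → (Fin n → ℂ) → ℂ} (hP : IsHolPoly P) (hL : L.IsSymm)
    (hLint : ∀ v : Fin n → ℤ, ∃ t : ℤ, bil L (fun i => (v i : ℂ)) (fun i => (v i : ℂ)) = t)
    (hmod : ∀ γ ∈ CongruenceSubgroup.Gamma0 2,
      jacSlash k L γ (fun x τ => P x τ (nu τ) (alpha x τ)) =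
        fun x τ => P x τ (nu τ) (alpha x τ))
    (hell : IsElliptic L fun x τ => P x τ (nu τ) (alpha x τ))
    (h0 : ∀ x τ, P x (upper (1 / (m : ℝ)) • τ) 0 0 = P x τ 0 0) :
    ∃ C : ℂ, (L ≠ 0 ∨ k ≠ 0 → C = 0) ∧ ∀ x τ, P x τ 0 0 = C := by
  set Φ : (Fin n → ℂ) → ℍ → ℂ := fun x τ => P x τ (nu τ) (alpha x τ) with hΦ
  have hmod' : ∀ g ∈ (CongruenceSubgroup.Gamma0 2).map
      (Matrix.SpecialLinearGroup.map (n := Fin 2) (Int.castRingHom ℝ)), IsInvariant k L Φ g := by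
    rintro _ ⟨γ, hγ, rfl⟩
    exact isInvariant_of_jacSlash_eq (hmod γ hγ)
  have hT : IsInvariant k L Φ (upper (1 / (m : ℝ))) := by
    intro x τ
    have h := hP.upper_smul_eq hmod' hell hLint (by omega) h0 x τ (nu τ) (alpha x τ)
    have hnu : nu (upper (1 / (m : ℝ)) • τ) = nu τ := by rw [nu, nu, im_upper_smul]
    have hal : alpha x (upper (1 / (m : ℝ)) • τ) = alpha x τ := by
      funext l
      rw [alpha, alpha, im_upper_smul]
    simp only [J_upper, div_one, factor, one_zpow, upper_10, Complex.ofReal_zero, zero_mul,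
      e_zero, one_mul]
    rw [hΦ]
    simp only [hnu, hal]
    exact h
  have hinv : ∀ g, IsInvariant k L Φ g := by
    have hle : extendedGamma m ≤ invariance k L Φ := by
      refine (Subgroup.closure_le _).2 (Set.union_subset (fun g hg => hmod' g hg) ?_)
      rintro _ rfl
      exact hT
    intro g
    exact closure_minimal hle (isClosed_invariance hP.continuous) (dense_extendedGamma hm g)
  obtain ⟨C, hC, h⟩ := exists_eq_const_of_isInvariant hL hinv fun mu x τ => by
    simpa [bil, e_zero] using hell 0 mu x τ
  refine ⟨C, hC, fun x τ => sub_eq_zero.1 ?_⟩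
  refine eq_zero_of_eq_zero_nu_alpha (G := fun x τ N A => P x τ N A - C) (fun N A => ?_)
    (fun x τ => ?_) (fun x τ => sub_eq_zero.2 (h x τ)) x τ 0 0
  · exact (hP.jacHol N A).sub (differentiableOn_const C)
  · exact (hP.differentiable x τ).sub_const C

lemma e_mul_upper_smul {m : ℕ} (hm : m ≠ 0) (l : ℤ) (τ : ℍ) :
    e (((m * l : ℤ) : ℂ) * (upper (1 / (m : ℝ)) • τ : ℍ)) = e (((m * l : ℤ) : ℂ) * τ) := by
  have hmC : (m : ℂ) ≠ 0 := by exact_mod_cast hm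
  rw [coe_upper_smul, mul_add, e_add,
    show ((m * l : ℤ) : ℂ) * ((1 / (m : ℝ) : ℝ) : ℂ) = (l : ℂ) by push_cast; field_simp,
    e_int, mul_one]

/-- A quasi-modular form is treated as a quasi-Jacobi form in `n = 0` elliptic variables. -/
theorem quasiModularForm_rigidity {m : ℕ} (hm : 2 < m) {k : ℤ} {f : ℍ → ℂ}
    (hf : IsQuasiModularForm k (CongruenceSubgroup.Gamma0 2) f)
    (ha : ∃ a : ℕ → ℂ, ∀ τ : ℍ,
      HasSum (fun l : ℕ => a l * e (((l * m : ℕ) : ℂ) * (τ : ℂ))) (f τ)) :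
    ∃ C : ℂ, (k ≠ 0 → C = 0) ∧ ∀ τ, f τ = C := by
  obtain ⟨F, φ, hF, ⟨hφ, hFφ⟩, rfl⟩ := hf
  obtain ⟨a, ha⟩ := ha
  -- `y⁻¹ = 8πν`
  let P : (Fin 0 → ℂ) → ℍ → ℂ → (Fin 0 → ℂ) → ℂ := fun _ τ N _ =>
    φ.sum fun j g => g τ * (8 * Real.pi * N) ^ j
  have hP : IsHolPoly P := by
    refine ⟨?_, fun x τ => ⟨φ.sum fun j g => MvPolynomial.C (g τ) *
      (MvPolynomial.C (8 * Real.pi : ℂ) * MvPolynomial.X none) ^ j, fun N A => ?_⟩⟩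
    · simp only [P, Finsupp.sum]
      refine DifferentiableOn.fun_sum fun j _ => DifferentiableOn.mul ?_ (by fun_prop)
      exact DifferentiableOn.comp (g := fun z : ℂ => φ j (ofComplex z)) (hφ j)
        (by fun_prop) fun p hp => hp
    · simp [P, Finsupp.sum, map_sum]
  have hPF : (fun x τ => P x τ (nu τ) (alpha x τ)) = fun _ τ => F τ := by
    funext x τ
    have hτ : (τ.im : ℂ) ≠ 0 := by exact_mod_cast τ.im_pos.ne'
    rw [hFφ, show (τ.im : ℂ)⁻¹ = 8 * Real.pi * nu τ by rw [nu]; field_simp]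
  have hP0 : ∀ x τ, P x τ 0 0 = φ 0 τ := by
    intro x τ
    simp only [P]
    rw [Finsupp.sum_of_support_subset _ (Finset.subset_insert 0 φ.support) _ (by simp),
      Finset.sum_eq_single 0 (fun j _ hj => by simp [hj]) (by simp)]
    simp
  have hbil : ∀ x y : Fin 0 → ℂ, bil 0 x y = 0 := fun x y => by simp [bil]
  suffices ∃ C : ℂ, ((0 : Matrix (Fin 0) (Fin 0) ℚ) ≠ 0 ∨ k ≠ 0 → C = 0) ∧
      ∀ x τ, P x τ 0 0 = C by
    obtain ⟨C, hC, h⟩ := this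
    exact ⟨C, fun hk => hC (Or.inr hk), fun τ => (hP0 0 τ).symm.trans (h 0 τ)⟩
  refine exists_eq_const_of_periodic hm hP (by simp)
    (fun v => ⟨0, by simp [hbil]⟩) (fun γ hγ => ?_) (fun lam mu x τ => ?_) (fun x τ => ?_)
  · rw [hPF]
    funext x τ
    have h := congrFun (hF.slash_eq γ hγ) τ
    rw [ModularForm.SL_slash_apply] at h
    rw [jacSlash, hbil, mul_zero, zero_div, neg_zero, e_zero, mul_one, mul_comm]
    exact h
  · rw [hPF]
    simp [hbil, e_zero]
  · rw [hP0 x, hP0 x]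
    refine (ha _).unique ?_
    convert ha τ using 2 with l
    have h := e_mul_upper_smul (by omega : m ≠ 0) l τ
    push_cast at h ⊢
    rw [mul_comm (l : ℂ), h]

lemma differentiable_prod_pow (j : Fin n → ℕ) :
    Differentiable ℂ fun A : Fin n → ℂ => ∏ l, A l ^ j l := fun A =>
  (HasFDerivAt.finsetProd fun l _ =>
    (by fun_prop :
      DifferentiableAt ℂ (fun A : Fin n → ℂ => A l ^ j l) A).hasFDerivAt).differentiableAt

theorem quasiJacobiForm_rigidity {m : ℕ} (hm : 2 < m) {k : ℤ} {L : Matrix (Fin n) (Fin n) ℚ}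
    {f : (Fin n → ℂ) → ℍ → ℂ} (hL : IsIndex ⊤ L)
    (hf : IsQuasiJacobiForm k L (CongruenceSubgroup.Gamma0 2) ⊤ f)
    (hc : ∃ c : ℤ → (Fin n → ℤ) → ℂ,
      (∀ (x : Fin n → ℂ) (τ : ℍ),
        HasSum (fun p : ℤ × (Fin n → ℤ) =>
          c p.1 p.2 * e ((p.1 : ℂ) * (τ : ℂ)) * e (∑ i, x i * (p.2 i : ℂ))) (f x τ)) ∧
      ∀ v r, c v r ≠ 0 → ∃ l : ℤ, v = m * l) :
    ∃ C : ℂ, (L ≠ 0 ∨ k ≠ 0 → C = 0) ∧ ∀ x τ, f x τ = C := by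
  obtain ⟨Φ, φ, hΦ, ⟨hφ, hΦφ⟩, rfl⟩ := hf
  obtain ⟨c, hc, hc'⟩ := hc
  let P : (Fin n → ℂ) → ℍ → ℂ → (Fin n → ℂ) → ℂ := fun x τ N A =>
    φ.sum fun p g => g x τ * N ^ p.1 * ∏ l, A l ^ p.2 l
  have hP : IsHolPoly P := by
    refine ⟨?_, fun x τ => ⟨φ.sum fun p g => MvPolynomial.C (g x τ) *
      MvPolynomial.X none ^ p.1 * ∏ l, MvPolynomial.X (some l) ^ p.2 l, fun N A => ?_⟩⟩
    · simp only [P, Finsupp.sum]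
      refine DifferentiableOn.fun_sum fun p _ =>
        DifferentiableOn.mul (DifferentiableOn.mul ?_ (by fun_prop))
          ((differentiable_prod_pow p.2).comp (by fun_prop)).differentiableOn
      exact (hφ p).comp (by fun_prop) (by fun_prop) fun p hp => hp
    · simp [P, Finsupp.sum, map_sum, map_prod]
  have hPΦ : (fun x τ => P x τ (nu τ) (alpha x τ)) = Φ := by
    funext x τ
    rw [hΦφ]
  have hP0 : ∀ x τ, P x τ 0 0 = φ (0, 0) x τ := by
    intro x τ
    simp only [P]
    rw [Finsupp.sum_of_support_subset _ (Finset.subset_insert (0, 0) φ.support) _ (by simp),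
      Finset.sum_eq_single (0, 0) (fun p _ hp => ?_) (by simp)]
    · simp
    · rcases eq_or_ne p.1 0 with h1 | h1
      · have h2 : p.2 ≠ 0 := fun h2 => hp (Prod.ext h1 h2)
        obtain ⟨l, hl⟩ := Function.ne_iff.1 h2
        rw [Finset.prod_eq_zero (Finset.mem_univ l) (by simpa using hl), mul_zero]
      · simp [h1]
  suffices ∃ C : ℂ, (L ≠ 0 ∨ k ≠ 0 → C = 0) ∧ ∀ x τ, P x τ 0 0 = C by simpa only [hP0] using this
  refine exists_eq_const_of_periodic hm hP hL.1
    (fun v => ?_) (fun γ hγ => ?_) (fun lam mu x τ => ?_) (fun x τ => ?_)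
  · obtain ⟨t, ht⟩ := hL.2 (Matrix.vecMulVec v v)
      (AddSubgroup.subset_closure ⟨(v, v), trivial, Or.inl rfl⟩)
      (by ext i j; simp [Matrix.vecMulVec_apply, mul_comm])
    refine ⟨t, ?_⟩
    have ht' : ((L * (Matrix.vecMulVec v v).map (Int.cast : ℤ → ℚ)).trace : ℂ) = t := by
      rw [ht]
      simp
    rw [← ht', bil, Matrix.trace]
    simp only [Matrix.diag_apply, Matrix.mul_apply, Matrix.map_apply, Matrix.vecMulVec_apply]
    push_cast
    refine Finset.sum_congr rfl fun i _ => Finset.sum_congr rfl fun j _ => ?_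
    ring
  · rw [hPΦ]
    exact hΦ.slash_eq γ hγ
  · rw [hPΦ]
    exact hΦ.elliptic (lam, mu) trivial x τ
  · rw [hP0, hP0]
    refine (hc x _).unique ?_
    convert hc x τ using 2 with p
    by_cases hp : c p.1 p.2 = 0
    · simp [hp]
    · obtain ⟨l, hl⟩ := hc' _ _ hp
      rw [hl, e_mul_upper_smul (by omega : m ≠ 0)]

end QuasiJacobi

end

theorem mainTheorem12 (m : ℕ) (hm : 2 < m) :
    -- quasi-modular forms
    (∀ (k : ℤ) (f : UpperHalfPlane → ℂ),
      QuasiJacobi.IsQuasiModularForm k (CongruenceSubgroup.Gamma0 2) f →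
      (∃ a : ℕ → ℂ, ∀ τ : UpperHalfPlane,
        HasSum (fun l : ℕ => a l * QuasiJacobi.e (((l * m : ℕ) : ℂ) * (τ : ℂ))) (f τ)) →
      (k ≠ 0 → f = 0) ∧ (k = 0 → ∃ C : ℂ, ∀ τ, f τ = C)) ∧
    -- quasi-Jacobi forms
    (∀ (n : ℕ) (k : ℤ) (L : Matrix (Fin n) (Fin n) ℚ) (f : (Fin n → ℂ) → UpperHalfPlane → ℂ),
      QuasiJacobi.IsIndex ⊤ L →
      QuasiJacobi.IsQuasiJacobiForm k L (CongruenceSubgroup.Gamma0 2) ⊤ f →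
      (∃ c : ℤ → (Fin n → ℤ) → ℂ,
        (∀ (x : Fin n → ℂ) (τ : UpperHalfPlane),
          HasSum (fun p : ℤ × (Fin n → ℤ) =>
            c p.1 p.2 * QuasiJacobi.e ((p.1 : ℂ) * (τ : ℂ)) *
              QuasiJacobi.e (∑ i, x i * (p.2 i : ℂ))) (f x τ)) ∧
        ∀ v r, c v r ≠ 0 → ∃ l : ℤ, v = m * l) →
      (L ≠ 0 ∨ k ≠ 0 → f = 0) ∧ (L = 0 ∧ k = 0 → ∃ C : ℂ, ∀ x τ, f x τ = C)) ∧
    -- density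
    Dense ((Subgroup.closure
      (((CongruenceSubgroup.Gamma0 2).map
          (Matrix.SpecialLinearGroup.map (n := Fin 2) (Int.castRingHom ℝ)) :
            Set (Matrix.SpecialLinearGroup (Fin 2) ℝ)) ∪
        {QuasiJacobi.upper (1 / (m : ℝ))}) :
      Subgroup (Matrix.SpecialLinearGroup (Fin 2) ℝ)) :
        Set (Matrix.SpecialLinearGroup (Fin 2) ℝ)) := by
  refine ⟨fun k f hf ha => ?_, fun n k L f hL hf hc => ?_, QuasiJacobi.dense_extendedGamma hm⟩
  · obtain ⟨C, hC, h⟩ := QuasiJacobi.quasiModularForm_rigidity hm hf ha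
    exact ⟨fun hk => funext fun τ => (h τ).trans (hC hk), fun _ => ⟨C, h⟩⟩
  · obtain ⟨C, hC, h⟩ := QuasiJacobi.quasiJacobiForm_rigidity hm hL hf hc
    exact ⟨fun hk => funext fun x => funext fun τ => (h x τ).trans (hC hk), fun _ => ⟨C, h⟩⟩
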